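/- For $|z|\le1$, $z\neq1$ and $v\in\mathbb C\setminus\{0,-1,-2,\dots\}$ let $\Phi(z,s,v)$ be the Lerch zeta function, i.e. the analytic continuation to $s\in\mathbb C$ of $\sum_{k\ge0}z^k(k+v)^{-s}$ ($\mathrm{Re}\,s>1$). For $|z|=1$, $z\ne1$, $N\in\mathbb Z^+$, $v>0$ set $$R(z,-N,1,0,v):=(-v)^N N\int_0^\infty\Bigl(\frac{e^{-u}}{1-ze^{-u}}-\sum_{m=0}^{N-1}\frac{(-u)^m\Phi(z,-m,1)}{m!}\Bigr)\frac{du}{u\,e^{vu}} .$$ Let $\mathcal H_k=\sum_{j=1}^k\frac1j$, $\zeta(s,a)=\sum_{k\geq0}(k+a)^{-s}$, and let $^\#$ be the operator that acts on Laurent series in $t$ with terms $t^{2k}$, $k\ge-1$, termwise by $(t^{2k})^\#:=(2\mathcal H_{2k+1}-\mathcal H_k)\,t^{2k}$ for $k\geq0$ and $(t^{-2})^\#:=0$. For a function with a pole at $t=0$, $^\#$ is applied to its Laurent expansion at $0$. Let $t\in\mathbb R$ with $0<|t|<2\pi$, and let $f$ be the continuous extension to $r\in\,]-\frac{2\pi}{|t|},\frac{2\pi}{|t|}[$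 of $$f(r)=\Bigl(\frac r{\sin\frac{tr}2}-\frac1{\sin\frac t2}\Bigr)\frac1{t(1-r^2)} .$$ For $\ell\in\mathbb Z$ put $\tilde\ell:=|\ell+1|$. The summands $\sum_{k=1}^{\tilde\ell}\frac{\sin((2k-\tilde\ell)t/2)}{\sin(t/2)}\log k$ and $\bigl(\frac{\cos(\tilde\ell t/2)}{t\sin(t/2)}\bigr)^\#$ of the Lie-algebra-equivariant torsion $T_{tX}(\mathbb P^1\mathbb C,\mathcal O(\ell))$ have the following asymptotic expansions for $\tilde\ell\to\infty$. (1) For all integers $N\ge1$ and $\tilde\ell\ge1$, \begin{align*} \sum_{k=1}^{\tilde\ell}\frac{\sin\frac{(2k-\tilde\ell)t}2}{\sin\frac t2}\log k={}&-\frac{\cos\frac{(\tilde\ell+1)t}2}{2\sin^2\frac t2}\log\tilde\ell\\ &-\frac1{2i\sin\frac t2}\Bigl(e^{-\frac{i(\tilde\ell-2)t}2}\tfrac{\partial\Phi}{\partial s}(e^{it},0,1)-e^{\frac{i(\tilde\ell-2)t}2}\tfrac{\partial\Phi}{\partial s}(e^{-it},0,1)\Bigr)\\ &+\frac1{2i\sin\frac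 t2}\sum_{m=1}^{N-1}\frac{(-\tilde\ell)^{-m}}m\Bigl(e^{\frac{i(\tilde\ell+2)t}2}\Phi(e^{it},-m,1)-e^{-\frac{i(\tilde\ell+2)t}2}\Phi(e^{-it},-m,1)\Bigr)\\ &+\frac1{2i\sin\frac t2}\frac{(-\tilde\ell)^{-N}}N\Bigl(e^{\frac{i(\tilde\ell+2)t}2}R(e^{it},-N,1,0,\tilde\ell)-e^{-\frac{i(\tilde\ell+2)t}2}R(e^{-it},-N,1,0,\tilde\ell)\Bigr), \end{align*} where $$|R(e^{\pm it},-N,1,0,\tilde\ell)|<\frac{N!}{(2\pi)^{N+1}}\Bigl(\zeta\bigl(N+1,\tfrac{|t|}{2\pi}\bigr)+\zeta\bigl(N+1,1-\tfrac{|t|}{2\pi}\bigr)\Bigr).$$ (2) For every $\tilde\ell$ the power series $\bigl(\frac{\cos(\tilde\ell t/2)}{t\sin(t/2)}\bigr)^\#$ converges at $t$, and if $t>0$ then for $\tilde\ell\to\infty$ and fixed $t$ \begin{align*} \Bigl(\frac{\cos\frac{\tilde\ell t}2}{t\sin\frac t2}\Bigr)^\#\sim{}&-\frac1{t\sin\frac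 t2}\Bigl(\sin\tfrac{\tilde\ell t}2\cdot\Bigl(\frac\pi2+\sum_{m=0}^\infty\frac{(-1)^m(2m)!}{(\tilde\ell t)^{2m+1}}\Bigr)\\ &\qquad+\cos\tfrac{\tilde\ell t}2\cdot\Bigl(-\log(\tilde\ell t)+\Gamma'(1)+\sum_{m=1}^\infty\frac{(-1)^m(2m-1)!}{(\tilde\ell t)^{2m}}\Bigr)\Bigr)\\ &+\sum_{m=1}^\infty2\Bigl(\frac2{\tilde\ell t}\Bigr)^m\cos\frac{\tilde\ell t+\pi m}2\cdot f^{(m-1)}(1), \end{align*} i.e. for every $N\ge0$ the difference between the left-hand side and the right-hand side, with only the terms containing powers $(\tilde\ell t)^{-j}$, $j<N$, of the three sums retained, is $O(\tilde\ell^{-N})$. -/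

import Mathlib

open Filter Topology

noncomputable section

/-- `F` is the analytic continuation in `s` of the Lerch series
`∑_{k ≥ 0} z ^ k / (k + v) ^ s` (`|z| ≤ 1`, `v ∉ {0, -1, -2, …}`) from the half-plane `Re s > 1`
to `ℂ` if `z ≠ 1`, and to `ℂ \ {1}` if `z = 1`. By the identity theorem `F` is unique there. -/
def IsLerchContinuation (z v : ℂ) (F : ℂ → ℂ) : Prop :=
  DifferentiableOn ℂ F {s | z ≠ 1 ∨ s ≠ 1} ∧
    ∀ s : ℂ, 1 < s.re → HasSum (fun k : ℕ => z ^ k / ((k : ℂ) + v) ^ s) (F s)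

/-- The Lerch zeta function `Φ(z, s, v)`, continued analytically in `s`. -/
def lerchPhi (z s v : ℂ) : ℂ :=
  Classical.epsilon (IsLerchContinuation z v) s

/-- The continuation exists for `|z| = 1`, `z ≠ 1`, `v = 1`, so that `lerchPhi` is not a junk value
there. -/
theorem isLerchContinuation_lerchPhi (t : ℝ) (ht : Complex.exp (Complex.I * t) ≠ 1) :
    IsLerchContinuation (Complex.exp (Complex.I * t)) 1
      (fun s => lerchPhi (Complex.exp (Complex.I * t)) s 1) := by
  have h : ∃ F, IsLerchContinuation (Complex.exp (Complex.I * t)) 1 F := by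
    have hpi : (Real.pi : ℂ) ≠ 0 := by exact_mod_cast Real.pi_ne_zero
    have ha : ((t / (2 * Real.pi) : ℝ) : UnitAddCircle) ≠ 0 := by
      intro h0
      obtain ⟨n, hn⟩ := (AddCircle.coe_eq_zero_iff (1 : ℝ)).1 h0
      apply ht
      rw [Complex.exp_eq_one_iff]
      refine ⟨n, ?_⟩
      have : t = n * (2 * Real.pi) := by
        have hp := Real.pi_pos
        rw [zsmul_eq_mul, mul_one] at hn
        field_simp at hn
        linarith
      rw [this]
      push_cast
      ring
    refine ⟨fun s => Complex.exp (-(Complex.I * t)) *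
      HurwitzZeta.expZeta ((t / (2 * Real.pi) : ℝ) : UnitAddCircle) s, ?_, ?_⟩
    · exact ((HurwitzZeta.differentiable_expZeta_of_ne_zero ha).const_mul _).differentiableOn
    · intro s hs
      have h1 := HurwitzZeta.hasSum_expZeta_of_one_lt_re (t / (2 * Real.pi)) hs
      rw [← hasSum_nat_add_iff' 1] at h1
      have hs0 : s ≠ 0 := by
        rintro rfl
        norm_num at hs
      simp only [Finset.range_one, Finset.sum_singleton, Nat.cast_zero,
        Complex.zero_cpow hs0, div_zero, sub_zero] at h1
      refine (h1.mul_left (Complex.exp (-(Complex.I * t)))).congr_fun ?_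
      intro k
      rw [← Complex.exp_nat_mul, ← mul_div_assoc, ← Complex.exp_add]
      push_cast
      congr 2
      field_simp
      ring
  exact Classical.epsilon_spec h

/-- The remainder `R(z, -N, a, n, v)` (for `|z| = 1`, integers `a ≥ 1`, `0 ≤ n < N` and `v > 0`):
`(-1)^N v^(N-n) N! / (N-n-1)!` times
`∫_0^∞ (e^(-au) / (1 - z e^(-u)) - ∑_{m < N} (-u)^m Φ(z,-m,a) / m!) u^(-n-1) e^(-vu) du`,
where in the case `z = 1` the singular term `1 / u` is subtracted from the integrand as well. -/
def lerchRemainder (z : ℂ) (N a n : ℕ) (v : ℝ) : ℂ :=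
  (-1) ^ N * (v : ℂ) ^ (N - n) * ((N.factorial : ℂ) / ((N - n - 1).factorial : ℂ)) *
    ∫ u in Set.Ioi (0 : ℝ),
      (Complex.exp (-(a * u)) / (1 - z * Complex.exp (-u)) - (if z = 1 then 1 / (u : ℂ) else 0)
        - ∑ m ∈ Finset.range N, (-(u : ℂ)) ^ m * lerchPhi z (-m) a / (m.factorial : ℂ))
      / ((u : ℂ) ^ (n + 1) * Complex.exp (v * u))

/-- The Hurwitz zeta value `ζ(p, a) = ∑_{k ≥ 0} (k + a)^(-p)` at an integer `p ≥ 2`, `a > 0`. -/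
def hurwitzSum (p : ℕ) (a : ℝ) : ℝ :=
  ∑' k : ℕ, 1 / ((k : ℝ) + a) ^ p

/-- `HasSharp g t S`: `S` is the value at `t` of `g^#`. Here `g` is a function with a Laurent
expansion `g(x) = ∑_{k ≥ -1} c_k x^(2k)` around `0` (`c j` below is the coefficient of
`x^(2j-2)`), and `#` is the linear operator acting on Laurent series by
`(x^(2k))^# = (2 H_{2k+1} - H_k) x^(2k)` for `k ≥ 0` and `(x^(-2))^# = 0`. The convergence of the
resulting power series at `t` is part of the assertion. -/
def HasSharp (g : ℝ → ℝ) (t S : ℝ) : Prop :=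
  ∃ c : ℕ → ℝ,
    (∀ᶠ x in 𝓝[≠] (0 : ℝ), HasSum (fun j : ℕ => c j * x ^ (2 * (j : ℤ) - 2)) (g x)) ∧
    HasSum (fun k : ℕ =>
      c (k + 1) * (2 * (harmonic (2 * k + 1) : ℝ) - (harmonic k : ℝ)) * t ^ (2 * k)) S

/-- The continuous extension of `r ↦ (r / sin(tr/2) - 1 / sin(t/2)) / (t (1 - r^2))` through its
removable singularities `-1, 0, 1`. -/
def torsionAux (t : ℝ) : ℝ → ℝ :=
  extendFrom ({-1, 0, 1} : Set ℝ)ᶜ fun r =>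
    (r / Real.sin (t * r / 2) - 1 / Real.sin (t / 2)) * (1 / (t * (1 - r ^ 2)))

end

/-! Part (1). Put z = e^{iθ} with 0 < θ < 2π and K(u) = e^{-u}/(1 - z e^{-u}) = ∑ z^k e^{-(k+1)u}.
For Re s > 1, the Mellin transform of (K(u) - K(0)) e^{-Lu}, divided by Γ(s), is the tail of the
Lerch series after L terms, up to the factor z^L, minus K(0) L^{-s}. Since K(u) - K(0) = O(u) at 0,
both sides continue to Re s > -1. There 1/Γ has a simple zero at s = 0 with derivative 1, so
differentiating at 0 leaves ∂Φ/∂s(z,0,1) + ∑_{k<L} z^k log(k+1) = z^L (∫ (K(u) - K(0)) e^{-Lu} du/u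
- K(0) log L) (`deriv_lerchPhi_zero`). Taylor expansion of K under the integral gives the powers of
1/L, and its Taylor remainder gives R. The sine sum is a combination of the results for e^{it} and
e^{-it}.

The sharp bound for R comes from zK(u) = -1/2 + (i/2) cot(π(x + iy)) with x = θ/2π, y = u/2π. In the
partial fractions of the cotangent the poles p are real and the increment iy is orthogonal to them,
so stopping the geometric expansion of 1/(p + iy) leaves an error below the modulus of the first
omitted term, for all y > 0 (`tsum_one_div_sub_expansion`). The functional equation of the periodic
zeta function identifies the coefficients with Φ(z,-m,1) (`norm_lerchKernel_sub_taylor_lt`).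

Part (2). The multiplier 2H_{2k+1} - H_k equals 2∑_{i≤k} 1/(2i+1) = 2∫_0^1 (1 - r^{2k+2})/(1 - r^2)
dr. With h(x) = x cos(Lx/2)/sin(x/2) the value of the #-series is therefore ∫_0^1 2(h(t) -
h(tr))/(t^2(1 - r^2)) dr (`hasSum_sharp`). With l = Lt/2 this splits into 1/(t sin(t/2)) ∫ 2(cos l -
cos lr)/(1 - r^2) dr and -2∫ f(r) cos(lr) dr (`sharp_integral_eq`). The first integral reduces to
the sine and cosine integrals at 2l, hence to the Laplace transforms of 1/(1+u^2) and u/(1+u^2),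
which have explicit expansions with remainder. The second is expanded by repeated integration by
parts; the boundary terms at 0 vanish because f is even. -/

/-! ### Partial fractions of the cotangent with a sharp remainder -/

theorem one_div_sub_eq_sum_add {p D : ℂ} (hp : p ≠ 0) (hpD : p - D ≠ 0) (n : ℕ) :
    1 / (p - D) - 1 / p =
      ∑ m ∈ Finset.range n, D ^ (m + 1) * (1 / p ^ (m + 2)) +
        D ^ (n + 1) * (1 / (p ^ (n + 1) * (p - D))) := by
  induction n with
  | zero => simp; field_simp; ring
  | succ n ih =>
    rw [ih, Finset.sum_range_succ]
    field_simp
    ring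

theorem norm_lt_norm_add_mul_I {p y : ℝ} (hy : y ≠ 0) :
    |p| < ‖(p : ℂ) - -(Complex.I * y)‖ := by
  rw [← Real.sqrt_sq_eq_abs]
  have : (p : ℂ) - -(Complex.I * y) = p + y * Complex.I := by ring
  rw [this, Complex.norm_add_mul_I]
  apply Real.sqrt_lt_sqrt (sq_nonneg _)
  have := sq_pos_of_ne_zero hy
  linarith

/-- Each term is a geometric expansion stopped after finitely many steps. Because |p + iy| > |p| for
real p, its remainder is strictly below y^(n+1)/|p|^(n+2). The sequence `p` is kept general so that
the statement serves both half-lattices k + x and -(k + 1 - x). -/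
theorem tsum_one_div_sub_expansion {p : ℕ → ℝ} (hp : ∀ k, p k ≠ 0)
    (hs : ∀ m : ℕ, 2 ≤ m → Summable fun k => 1 / |p k| ^ m) {y : ℝ} (hy : 0 < y) (n : ℕ) :
    Summable (fun k => 1 / ((p k : ℂ) - -(Complex.I * y)) - 1 / (p k : ℂ)) ∧
    ‖∑' k, (1 / ((p k : ℂ) - -(Complex.I * y)) - 1 / (p k : ℂ)) -
      ∑ m ∈ Finset.range n, (-(Complex.I * y)) ^ (m + 1) * ∑' k, 1 / (p k : ℂ) ^ (m + 2)‖ <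
      y ^ (n + 1) * ∑' k, 1 / |p k| ^ (n + 2) := by
  have hlt : ∀ k, |p k| < ‖(p k : ℂ) - -(Complex.I * y)‖ := fun k => norm_lt_norm_add_mul_I hy.ne'
  have hne : ∀ k, (p k : ℂ) - -(Complex.I * y) ≠ 0 := fun k =>
    norm_pos_iff.1 ((abs_nonneg _).trans_lt (hlt k))
  have hpc : ∀ k, (p k : ℂ) ≠ 0 := fun k => by exact_mod_cast hp k
  have hpos : ∀ k, 0 < |p k| := fun k => abs_pos.2 (hp k)
  have hterm : ∀ m : ℕ, Summable fun k => 1 / (p k : ℂ) ^ (m + 2) := fun m => by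
    refine Summable.of_norm ?_
    simpa using hs (m + 2) (by omega)
  have hnorm : ∀ k, ‖1 / ((p k : ℂ) ^ (n + 1) * ((p k : ℂ) - -(Complex.I * y)))‖ <
      1 / |p k| ^ (n + 2) := fun k => by
    rw [norm_div, norm_one, norm_mul, norm_pow, Complex.norm_real, Real.norm_eq_abs,
      pow_succ _ (n + 1)]
    exact one_div_lt_one_div_of_lt (mul_pos (pow_pos (hpos k) _) (hpos k))
      (mul_lt_mul_of_pos_left (hlt k) (pow_pos (hpos k) _))
  have hremn : Summable fun k => ‖1 / ((p k : ℂ) ^ (n + 1) * ((p k : ℂ) - -(Complex.I * y)))‖ :=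
    Summable.of_nonneg_of_le (fun _ => norm_nonneg _) (fun k => (hnorm k).le)
      (hs (n + 2) (by omega))
  have hsum := (hasSum_sum fun m (_ : m ∈ Finset.range n) =>
    (hterm m).hasSum.mul_left ((-(Complex.I * y)) ^ (m + 1))).add
      (hremn.of_norm.hasSum.mul_left ((-(Complex.I * y)) ^ (n + 1)))
  have hsum' := hsum.congr_fun fun k => (one_div_sub_eq_sum_add (hpc k) (hne k) n)
  refine ⟨hsum'.summable, ?_⟩
  rw [hsum'.tsum_eq, add_sub_cancel_left, norm_mul, norm_pow, norm_neg, norm_mul, Complex.norm_I,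
    one_mul, Complex.norm_real, Real.norm_of_nonneg hy.le]
  refine mul_lt_mul_of_pos_left ?_ (pow_pos hy _)
  exact (norm_tsum_le_tsum_norm hremn).trans_lt
    (Summable.tsum_lt_tsum (i := 0) (fun k => (hnorm k).le) (hnorm 0) hremn (hs (n + 2) (by omega)))

theorem summable_one_div_nat_add_pow {a : ℝ} (ha : 0 < a) {m : ℕ} (hm : 2 ≤ m) :
    Summable fun k : ℕ => 1 / ((k : ℝ) + a) ^ m := by
  have := (Real.summable_one_div_nat_add_rpow a m).2 (by exact_mod_cast hm)
  refine this.congr fun k => ?_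
  rw [abs_of_pos (by positivity), Real.rpow_natCast]

/-- The sum of 1/(p + iy) over one half-lattice diverges. Subtracting the value at y = 0 makes each
half converge absolutely, so the symmetric pairing in the cotangent series can be undone. -/
theorem pi_mul_cot_sub {x y : ℝ} (hx0 : 0 < x) (hx1 : x < 1) (hy : 0 < y) :
    (Real.pi : ℂ) * (Real.pi * ((x : ℂ) - -(Complex.I * y))).cot - Real.pi * (Real.pi * (x : ℂ)).cot
      = ∑' k : ℕ, (1 / (((k + x : ℝ) : ℂ) - -(Complex.I * y)) - 1 / ((k + x : ℝ) : ℂ)) +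
        ∑' k : ℕ, (1 / (((-(k + (1 - x)) : ℝ) : ℂ) - -(Complex.I * y)) -
          1 / ((-(k + (1 - x)) : ℝ) : ℂ)) := by
  have h1 : (x : ℂ) - -(Complex.I * y) ∈ Complex.integerComplement := by
    rintro ⟨n, hn⟩
    have := congrArg Complex.im hn
    simp at this
    exact hy.ne this
  have h2 : (x : ℂ) ∈ Complex.integerComplement := by
    rintro ⟨n, hn⟩
    have hn' : (n : ℝ) = x := by exact_mod_cast hn
    rw [← hn'] at hx0 hx1
    have h3 : 0 < n := by exact_mod_cast hx0
    have h4 : n < 1 := by exact_mod_cast hx1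
    omega
  have hp := (tsum_one_div_sub_expansion (p := fun k : ℕ => (k + x : ℝ)) (fun k => by positivity)
    (fun m hm => (summable_one_div_nat_add_pow hx0 hm).congr fun k => by
      rw [abs_of_pos (by positivity)]) hy 0).1.hasSum
  have hx1' : 0 < 1 - x := by linarith
  have hq := (tsum_one_div_sub_expansion (p := fun k : ℕ => (-(k + (1 - x)) : ℝ))
    (fun k => neg_ne_zero.2 (by positivity))
    (fun m hm => (summable_one_div_nat_add_pow hx1' hm).congr fun k => by
      rw [abs_neg, abs_of_pos (by positivity)]) hy 0).1.hasSum
  -- Dropping the pole at k = 0 pairs x + (k+1) with x - (k+1), as in `cotTerm`; the dropped term is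
  -- the isolated 1/x of the cotangent series.
  have hp' := (hasSum_nat_add_iff' 1).2 hp
  have hc := (summable_cotTerm h1).hasSum.sub (summable_cotTerm h2).hasSum
  have hc' := (hp'.add hq).unique (hc.congr_fun fun k => by
    simp only [cotTerm]
    push_cast
    rw [show (x : ℂ) - -(Complex.I * y) - (k + 1) = -(k + (1 - x)) - -(Complex.I * y) by ring,
      show (x : ℂ) - (k + 1) = -(k + (1 - x)) by ring,
      show (x : ℂ) - -(Complex.I * y) + (k + 1) = (k + 1 + x) - -(Complex.I * y) by ring,
      show (x : ℂ) + (k + 1) = k + 1 + x by ring]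
    ring)
  have e1 := cot_series_rep' h1
  have e2 := cot_series_rep' h2
  simp only [cotTerm] at hc'
  rw [← e1, ← e2] at hc'
  simp at hc' ⊢
  linear_combination -hc'

/-! ### The Lerch kernel and its Taylor expansion -/

/-- The kernel `e^(-u) / (1 - z e^(-u))` whose Mellin transform is `Γ(s) Φ(z, s, 1)`. -/
noncomputable def lerchKernel (z : ℂ) (u : ℝ) : ℂ :=
  Complex.exp (-u) / (1 - z * Complex.exp (-u))

theorem exp_I_mul_ne_one {θ : ℝ} (h0 : 0 < θ) (h1 : θ < 2 * Real.pi) :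
    Complex.exp (Complex.I * θ) ≠ 1 := by
  intro h
  obtain ⟨n, hn⟩ := Complex.exp_eq_one_iff.1 h
  have hn' : θ = n * (2 * Real.pi) := by
    have := congrArg Complex.im hn
    simpa using this
  have hpi := Real.two_pi_pos
  rw [hn'] at h0 h1
  have h3 : (0 : ℝ) < n := pos_of_mul_pos_left h0 hpi.le
  have h4 : (n : ℝ) < 1 := by nlinarith
  have h3' : 0 < n := by exact_mod_cast h3
  have h4' : n < 1 := by exact_mod_cast h4
  omega

theorem norm_exp_I_mul (θ : ℝ) : ‖Complex.exp (Complex.I * θ)‖ = 1 := by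
  rw [mul_comm, Complex.norm_exp_ofReal_mul_I]

theorem one_sub_mul_exp_neg_ne_zero {z : ℂ} (hz : ‖z‖ = 1) (hz1 : z ≠ 1) {u : ℝ} (hu : 0 ≤ u) :
    1 - z * Complex.exp (-u) ≠ 0 := by
  intro h
  have h1 : z * Complex.exp (-u) = 1 := (sub_eq_zero.1 h).symm
  have h2 := congrArg norm h1
  rw [norm_mul, hz, one_mul, norm_one, Complex.norm_exp] at h2
  have h3 : u = 0 := by simpa using h2
  subst h3
  apply hz1
  simpa using h1

theorem differentiable_lerchPhi {θ : ℝ} (h0 : 0 < θ) (h1 : θ < 2 * Real.pi) :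
    Differentiable ℂ fun s => lerchPhi (Complex.exp (Complex.I * θ)) s 1 := by
  have hz := exp_I_mul_ne_one h0 h1
  have := (isLerchContinuation_lerchPhi θ hz).1
  simpa [hz, differentiableOn_univ] using this

theorem hasSum_lerchPhi {θ : ℝ} (h0 : 0 < θ) (h1 : θ < 2 * Real.pi) {s : ℂ} (hs : 1 < s.re) :
    HasSum (fun k : ℕ => Complex.exp (Complex.I * θ) ^ k / ((k : ℂ) + 1) ^ s)
      (lerchPhi (Complex.exp (Complex.I * θ)) s 1) :=
  (isLerchContinuation_lerchPhi θ (exp_I_mul_ne_one h0 h1)).2 s hs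

theorem Differentiable.eq_of_eqOn_one_lt_re {f g : ℂ → ℂ} (hf : Differentiable ℂ f)
    (hg : Differentiable ℂ g) (h : ∀ s : ℂ, 1 < s.re → f s = g s) : f = g := by
  refine AnalyticOnNhd.eq_of_eventuallyEq (𝕜 := ℂ) (z₀ := 2) (fun z _ => hf.analyticAt z)
    (fun z _ => hg.analyticAt z) ?_
  filter_upwards [(isOpen_lt continuous_const Complex.continuous_re).mem_nhds
    (show (1 : ℝ) < (2 : ℂ).re by norm_num)] with s hs using h s hs

/-- An index shift turns the series of zΦ(z,s,1) into the periodic zeta series, and both sides are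
entire. This makes the functional equation of `expZeta` available for Φ. -/
theorem exp_mul_lerchPhi_eq_expZeta {θ : ℝ} (h0 : 0 < θ) (h1 : θ < 2 * Real.pi) (s : ℂ) :
    Complex.exp (Complex.I * θ) * lerchPhi (Complex.exp (Complex.I * θ)) s 1 =
      HurwitzZeta.expZeta ((θ / (2 * Real.pi) : ℝ) : UnitAddCircle) s := by
  have hpi : (Real.pi : ℂ) ≠ 0 := by exact_mod_cast Real.pi_ne_zero
  have hpi2 := Real.two_pi_pos
  have ha : ((θ / (2 * Real.pi) : ℝ) : UnitAddCircle) ≠ 0 := by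
    intro hh
    obtain ⟨n, hn⟩ := (AddCircle.coe_eq_zero_iff (1 : ℝ)).1 hh
    rw [zsmul_eq_mul, mul_one] at hn
    have a0 : (0 : ℝ) < n := hn ▸ by positivity
    have a1 : (n : ℝ) < 1 := hn ▸ (div_lt_one hpi2).2 h1
    have a0' : 0 < n := by exact_mod_cast a0
    have a1' : n < 1 := by exact_mod_cast a1
    omega
  refine congrFun (Differentiable.eq_of_eqOn_one_lt_re
    ((differentiable_lerchPhi h0 h1).const_mul _)
    (HurwitzZeta.differentiable_expZeta_of_ne_zero ha) fun s hs => ?_) s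
  have e1 := HurwitzZeta.hasSum_expZeta_of_one_lt_re (θ / (2 * Real.pi)) hs
  rw [← hasSum_nat_add_iff' 1] at e1
  have hs0 : s ≠ 0 := by
    rintro rfl
    norm_num at hs
  simp only [Finset.range_one, Finset.sum_singleton, Nat.cast_zero,
    Complex.zero_cpow hs0, div_zero, sub_zero] at e1
  refine ((hasSum_lerchPhi h0 h1 hs).mul_left _).unique (e1.congr_fun fun k => ?_)
  rw [← Complex.exp_nat_mul, ← mul_div_assoc, ← Complex.exp_add]
  push_cast
  congr 2
  field_simp
  ring

/-- This is the functional equation at 1 - s = -(m+1), that is s = m+2, where the Gamma factor is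
(m+1)! and the exponential factors are (±i)^(m+2). The sign (-1)^(m+2) is absorbed by placing the
second half-lattice on the negative axis, which matches the poles of the cotangent. -/
theorem exp_mul_lerchPhi_neg_nat {θ : ℝ} (h0 : 0 < θ) (h1 : θ < 2 * Real.pi) (m : ℕ) :
    Complex.exp (Complex.I * θ) * lerchPhi (Complex.exp (Complex.I * θ)) (-(m + 1 : ℕ)) 1 =
      ((m + 1).factorial : ℂ) * (Complex.I / (2 * Real.pi)) ^ (m + 2) *
        (∑' k : ℕ, 1 / ((k + θ / (2 * Real.pi) : ℝ) : ℂ) ^ (m + 2) +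
          ∑' k : ℕ, 1 / ((-(k + (1 - θ / (2 * Real.pi))) : ℝ) : ℂ) ^ (m + 2)) := by
  have hpi2 := Real.two_pi_pos
  set x : ℝ := θ / (2 * Real.pi) with hx
  have hx0 : 0 < x := by positivity
  have hx1 : x < 1 := (div_lt_one hpi2).2 h1
  have hs : (1 : ℝ) < ((m + 2 : ℕ) : ℂ).re := by
    rw [Complex.natCast_re]; push_cast; linarith [(Nat.cast_nonneg m : (0 : ℝ) ≤ m)]
  have hne : ∀ n : ℕ, ((m + 2 : ℕ) : ℂ) ≠ 1 - n := by
    intro n h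
    have h' : ((m + 2 + n : ℕ) : ℂ) = (1 : ℕ) := by push_cast at h ⊢; rw [h]; ring
    have := Nat.cast_injective h'
    omega
  have key := HurwitzZeta.expZeta_one_sub (x : UnitAddCircle) hne
  have z1 := HurwitzZeta.hasSum_hurwitzZeta_of_one_lt_re ⟨hx0.le, hx1.le⟩ hs
  have z2 := HurwitzZeta.hasSum_hurwitzZeta_of_one_lt_re (a := 1 - x)
    ⟨by linarith, by linarith⟩ hs
  have hneg : ((1 - x : ℝ) : UnitAddCircle) = -(x : UnitAddCircle) := by
    rw [AddCircle.coe_sub, AddCircle.coe_period, zero_sub]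
  rw [hneg] at z2
  rw [exp_mul_lerchPhi_eq_expZeta h0 h1, ← hx,
    show (-((m + 1 : ℕ) : ℂ)) = 1 - ((m + 2 : ℕ) : ℂ) by push_cast; ring, key, ← z1.tsum_eq,
    ← z2.tsum_eq]
  have g1 : Complex.Gamma ((m + 2 : ℕ) : ℂ) = ((m + 1).factorial : ℂ) := by
    rw [← Complex.Gamma_nat_eq_factorial]; congr 1; push_cast; ring
  have g2 : Complex.exp (Real.pi * Complex.I * ((m + 2 : ℕ) : ℂ) / 2) = Complex.I ^ (m + 2) := by
    rw [show (Real.pi : ℂ) * Complex.I * ((m + 2 : ℕ) : ℂ) / 2 =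
      ((m + 2 : ℕ) : ℂ) * (Real.pi / 2 * Complex.I) by ring, Complex.exp_nat_mul,
      Complex.exp_pi_div_two_mul_I]
  have g3 : Complex.exp (-Real.pi * Complex.I * ((m + 2 : ℕ) : ℂ) / 2) =
      (-Complex.I) ^ (m + 2) := by
    rw [show -(Real.pi : ℂ) * Complex.I * ((m + 2 : ℕ) : ℂ) / 2 =
      ((m + 2 : ℕ) : ℂ) * (-Real.pi / 2 * Complex.I) by ring, Complex.exp_nat_mul,
      Complex.exp_neg_pi_div_two_mul_I]
  rw [g1, g2, g3, Complex.cpow_neg, Complex.cpow_natCast, div_pow]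
  have t2 : (-Complex.I) ^ (m + 2) * ∑' n : ℕ, 1 / ((n : ℂ) + ((1 - x : ℝ) : ℂ)) ^ ((m + 2 : ℕ) : ℂ)
      = Complex.I ^ (m + 2) * ∑' k : ℕ, 1 / ((-(k + (1 - x)) : ℝ) : ℂ) ^ (m + 2) := by
    rw [← tsum_mul_left, ← tsum_mul_left]
    congr 1
    ext k
    rw [Complex.cpow_natCast]
    push_cast
    rw [neg_pow ((k : ℂ) + _), neg_pow Complex.I]
    rcases neg_one_pow_eq_or ℂ (m + 2) with h | h <;> rw [h] <;>
      simp only [one_div, mul_inv, inv_neg, inv_one] <;> ring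
  have t1 : ∑' n : ℕ, 1 / ((n : ℂ) + (x : ℂ)) ^ ((m + 2 : ℕ) : ℂ) =
      ∑' k : ℕ, 1 / ((k + x : ℝ) : ℂ) ^ (m + 2) := by
    congr 1
    ext k
    rw [Complex.cpow_natCast]
    push_cast
    rfl
  rw [t2, t1]
  ring

/-- Both sides equal w/(1 - w) with w = e^{iθ-u} = e^{2πi(x+iy)}, where x = θ/2π and y = u/2π. -/
theorem exp_mul_lerchKernel {θ : ℝ} (h0 : 0 < θ) (h1 : θ < 2 * Real.pi) {u : ℝ} (hu : 0 ≤ u) :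
    Complex.exp (Complex.I * θ) * lerchKernel (Complex.exp (Complex.I * θ)) u =
      -1 / 2 + Complex.I / (2 * Real.pi) * (Real.pi *
        (Real.pi * (((θ / (2 * Real.pi) : ℝ) : ℂ) -
          -(Complex.I * ((u / (2 * Real.pi) : ℝ) : ℂ)))).cot) := by
  have hpi : (Real.pi : ℂ) ≠ 0 := by exact_mod_cast Real.pi_ne_zero
  have hz := exp_I_mul_ne_one h0 h1
  have hn := one_sub_mul_exp_neg_ne_zero (norm_exp_I_mul θ) hz hu
  have e : Complex.exp (2 * Complex.I * (Real.pi * (((θ / (2 * Real.pi) : ℝ) : ℂ) -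
      -(Complex.I * ((u / (2 * Real.pi) : ℝ) : ℂ))))) =
      Complex.exp (Complex.I * θ) * Complex.exp (-u) := by
    rw [← Complex.exp_add]
    congr 1
    push_cast
    field_simp
    linear_combination (u : ℂ) * Complex.I_sq
  rw [Complex.cot_eq_exp_ratio, e, lerchKernel]
  field_simp
  ring

/-- After multiplication by z, of modulus 1, the kernel is a cotangent and the constant -1/2 cancels
in the difference. The bound is thus the one for the two half-lattices, valid for all u > 0 and not
only inside the disc of convergence of the Taylor series. -/
theorem norm_lerchKernel_sub_taylor_lt {θ : ℝ} (h0 : 0 < θ) (h1 : θ < 2 * Real.pi) {u : ℝ}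
    (hu : 0 < u) (n : ℕ) :
    ‖lerchKernel (Complex.exp (Complex.I * θ)) u - lerchKernel (Complex.exp (Complex.I * θ)) 0 -
      ∑ m ∈ Finset.range n, (-(u : ℂ)) ^ (m + 1) *
        lerchPhi (Complex.exp (Complex.I * θ)) (-(m + 1 : ℕ)) 1 / ((m + 1).factorial : ℂ)‖ <
      u ^ (n + 1) * ((1 / (2 * Real.pi) ^ (n + 2)) *
        (hurwitzSum (n + 2) (θ / (2 * Real.pi)) + hurwitzSum (n + 2) (1 - θ / (2 * Real.pi)))) := by
  have hpi2 := Real.two_pi_pos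
  have hpi : (Real.pi : ℂ) ≠ 0 := by exact_mod_cast Real.pi_ne_zero
  set x : ℝ := θ / (2 * Real.pi) with hx
  have hx0 : 0 < x := by positivity
  have hx1 : 0 < 1 - x := sub_pos.2 ((div_lt_one hpi2).2 h1)
  set y : ℝ := u / (2 * Real.pi) with hy
  have hy0 : 0 < y := by positivity
  set z := Complex.exp (Complex.I * θ) with hzdef
  have hp := (tsum_one_div_sub_expansion (p := fun k : ℕ => (k + x : ℝ)) (fun k => by positivity)
    (fun m hm => (summable_one_div_nat_add_pow hx0 hm).congr fun k => by
      rw [abs_of_pos (by positivity)]) hy0 n).2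
  have hq := (tsum_one_div_sub_expansion (p := fun k : ℕ => (-(k + (1 - x)) : ℝ))
    (fun k => neg_ne_zero.2 (by positivity))
    (fun m hm => (summable_one_div_nat_add_pow hx1 hm).congr fun k => by
      rw [abs_neg, abs_of_pos (by positivity)]) hy0 n).2
  have eP : ∑' k : ℕ, 1 / |(k : ℝ) + x| ^ (n + 2) = hurwitzSum (n + 2) x := by
    unfold hurwitzSum
    congr 1; ext k; rw [abs_of_pos (by positivity)]
  have eQ : ∑' k : ℕ, 1 / |(-((k : ℝ) + (1 - x)))| ^ (n + 2) = hurwitzSum (n + 2) (1 - x) := by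
    unfold hurwitzSum
    congr 1; ext k; rw [abs_neg, abs_of_pos (by positivity)]
  rw [eP] at hp
  rw [eQ] at hq
  have hcot := pi_mul_cot_sub hx0 (by linarith : x < 1) hy0
  have k1 := exp_mul_lerchKernel h0 h1 hu.le
  have k0 := exp_mul_lerchKernel h0 h1 le_rfl
  rw [← hx, ← hzdef] at k0 k1
  rw [← hy] at k1
  simp only [zero_div, Complex.ofReal_zero, mul_zero, neg_zero, sub_zero] at k0
  -- The powers match because -iy = -u · i/(2π): of the m+2 factors i/(2π) in the functional
  -- equation, m+1 belong to (-iy)^(m+1) and one is the prefactor of the cotangent.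
  have hsum : z * ∑ m ∈ Finset.range n, (-(u : ℂ)) ^ (m + 1) * lerchPhi z (-(m + 1 : ℕ)) 1 /
      ((m + 1).factorial : ℂ) = Complex.I / (2 * Real.pi) *
      (∑ m ∈ Finset.range n, (-(Complex.I * y)) ^ (m + 1) *
          ∑' k : ℕ, 1 / ((k + x : ℝ) : ℂ) ^ (m + 2) +
        ∑ m ∈ Finset.range n, (-(Complex.I * y)) ^ (m + 1) *
          ∑' k : ℕ, 1 / ((-(k + (1 - x)) : ℝ) : ℂ) ^ (m + 2)) := by
    rw [← Finset.sum_add_distrib, Finset.mul_sum, Finset.mul_sum]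
    refine Finset.sum_congr rfl fun m _ => ?_
    have := exp_mul_lerchPhi_neg_nat h0 h1 m
    rw [← hzdef, ← hx] at this
    have hf : ((m + 1).factorial : ℂ) ≠ 0 := by exact_mod_cast Nat.factorial_ne_zero _
    rw [← mul_add, mul_div_assoc', mul_left_comm, this, mul_assoc ((m + 1).factorial : ℂ),
      mul_left_comm, mul_div_cancel_left₀ _ hf, ← mul_assoc, ← mul_assoc]
    congr 1
    rw [hy]
    push_cast
    rw [show -(Complex.I * ((u : ℂ) / (2 * Real.pi))) = -(u : ℂ) * (Complex.I / (2 * Real.pi)) by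
      ring, mul_pow]
    ring
  have hz1 : ‖z‖ = 1 := norm_exp_I_mul θ
  have hzn : ∀ w : ℂ, ‖w‖ = ‖z * w‖ := fun w => by rw [norm_mul, hz1, one_mul]
  rw [hzn, mul_sub, mul_sub, k1, k0, hsum]
  rw [show ∀ a b c d : ℂ, -1 / 2 + c * a - (-1 / 2 + c * b) - c * d = c * (a - b - d) by
    intros; ring, hcot, add_sub_add_comm, norm_mul]
  have hI : ‖Complex.I / (2 * Real.pi)‖ = 1 / (2 * Real.pi) := by
    rw [norm_div, Complex.norm_I]
    norm_num [abs_of_pos Real.pi_pos]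
  rw [hI]
  calc 1 / (2 * Real.pi) * _ < 1 / (2 * Real.pi) * (y ^ (n + 1) * hurwitzSum (n + 2) x +
        y ^ (n + 1) * hurwitzSum (n + 2) (1 - x)) :=
        mul_lt_mul_of_pos_left ((norm_add_le _ _).trans_lt (add_lt_add hp hq)) (by positivity)
    _ = _ := by
        rw [hy, div_pow, pow_succ _ (n + 1)]
        field_simp

theorem lerchKernel_zero (z : ℂ) : lerchKernel z 0 = 1 / (1 - z) := by
  simp [lerchKernel]

theorem continuousOn_lerchKernel {z : ℂ} (hz : ‖z‖ = 1) (hz1 : z ≠ 1) :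
    ContinuousOn (lerchKernel z) (Set.Ici 0) := by
  unfold lerchKernel
  refine ContinuousOn.div (by fun_prop) (by fun_prop) fun u hu =>
    one_sub_mul_exp_neg_ne_zero hz hz1 hu

theorem hasSum_lerchKernel {z : ℂ} (hz : ‖z‖ = 1) {u : ℝ} (hu : 0 < u) :
    HasSum (fun k : ℕ => z ^ k * Complex.exp (-((k + 1) * u))) (lerchKernel z u) := by
  have h : ‖z * Complex.exp (-u)‖ < 1 := by
    rw [norm_mul, hz, one_mul, Complex.norm_exp]
    simpa using hu
  refine ((hasSum_geometric_of_norm_lt_one h).mul_left (Complex.exp (-u))).congr_fun fun k => ?_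
  rw [mul_pow, ← Complex.exp_nat_mul, mul_left_comm, ← Complex.exp_add]
  congr 2
  ring

/-! ### Mellin transform of the damped kernel and the derivative of Φ at s = 0 -/

/-- The difference of the Lerch kernel and its value at `0`, damped by `e^(-Lu)`. -/
noncomputable def lerchKernelDiff (z : ℂ) (L : ℕ) (u : ℝ) : ℂ :=
  (lerchKernel z u - lerchKernel z 0) * Complex.exp (-(L * u))

theorem hasSum_mellin_lerchKernelDiff {z : ℂ} (hz : ‖z‖ = 1) {L : ℕ} (hL : 1 ≤ L) {s : ℂ}
    (hs : 1 < s.re) :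
    HasSum (fun k : ℕ => z ^ k / ((k + L + 1 : ℕ) : ℂ) ^ s)
      (mellin (lerchKernelDiff z L) s / Complex.Gamma s + lerchKernel z 0 / (L : ℂ) ^ s) := by
  have hLr : (0 : ℝ) < L := by exact_mod_cast hL
  have hG : Complex.Gamma s ≠ 0 := Complex.Gamma_ne_zero_of_re_pos (by linarith)
  -- The subtracted constant K(0) is treated as one more exponential e^{-Lu}, at index 0 of a
  -- Dirichlet series with exponents k + L. Its exponent is positive because L ≥ 1.
  let a : ℕ → ℂ := fun k => if k = 0 then -lerchKernel z 0 else z ^ (k - 1)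
  have key := hasSum_mellin (a := a) (p := fun k : ℕ => ((k + L : ℕ) : ℝ))
    (F := lerchKernelDiff z L) (s := s)
    (fun k => Or.inr (by push_cast; positivity)) (by linarith) (fun u hu => ?_) ?_
  · rw [← hasSum_nat_add_iff' 1] at key
    have hv : mellin (lerchKernelDiff z L) s / Complex.Gamma s + lerchKernel z 0 / (L : ℂ) ^ s =
        (mellin (lerchKernelDiff z L) s - ∑ i ∈ Finset.range 1,
          Complex.Gamma s * a i / (((i + L : ℕ) : ℝ) : ℂ) ^ s) / Complex.Gamma s := by
      simp only [a, Finset.range_one, Finset.sum_singleton, if_true, zero_add]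
      rw [Complex.ofReal_natCast]
      field_simp
      ring
    rw [hv]
    refine (key.div_const (Complex.Gamma s)).congr_fun fun k => ?_
    simp only [a, Nat.succ_ne_zero, if_false, Nat.add_sub_cancel]
    rw [mul_div_assoc, mul_div_cancel_left₀ _ hG, Complex.ofReal_natCast,
      show k + 1 + L = k + L + 1 by ring]
  · rw [← hasSum_nat_add_iff' 1]
    have hv : lerchKernelDiff z L u - ∑ i ∈ Finset.range 1,
        a i * (Real.exp (-((i + L : ℕ) : ℝ) * u) : ℂ) =
        lerchKernel z u * Complex.exp (-(L * u)) := by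
      simp only [a, lerchKernelDiff, Finset.range_one, Finset.sum_singleton, if_true, zero_add]
      push_cast
      ring_nf
    rw [hv]
    refine ((hasSum_lerchKernel hz hu).mul_right (Complex.exp (-(L * u)))).congr_fun fun k => ?_
    simp only [a, Nat.succ_ne_zero, if_false, Nat.add_sub_cancel]
    rw [mul_assoc, ← Complex.exp_add, Complex.ofReal_exp]
    congr 2
    push_cast
    ring
  · rw [← summable_nat_add_iff 1]
    refine Summable.congr ((Real.summable_one_div_nat_add_rpow ((L : ℝ) + 1) s.re).2 hs) fun k => ?_
    simp only [a, Nat.succ_ne_zero, if_false, Nat.add_sub_cancel, norm_pow, hz, one_pow]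
    rw [abs_of_pos (by positivity)]
    push_cast
    ring_nf

theorem mellin_lerchKernelDiff {θ : ℝ} (h0 : 0 < θ) (h1 : θ < 2 * Real.pi) {L : ℕ}
    (hL : 1 ≤ L) {s : ℂ} (hs : 1 < s.re) :
    Complex.exp (Complex.I * θ) ^ L *
        (mellin (lerchKernelDiff (Complex.exp (Complex.I * θ)) L) s * (Complex.Gamma s)⁻¹) =
      lerchPhi (Complex.exp (Complex.I * θ)) s 1 -
        ∑ k ∈ Finset.range L, Complex.exp (Complex.I * θ) ^ k * ((k + 1 : ℕ) : ℂ) ^ (-s) -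
        Complex.exp (Complex.I * θ) ^ L *
          (lerchKernel (Complex.exp (Complex.I * θ)) 0 * (L : ℂ) ^ (-s)) := by
  set z := Complex.exp (Complex.I * θ) with hz
  have e1 := (hasSum_mellin_lerchKernelDiff (norm_exp_I_mul θ) hL hs).mul_left (z ^ L)
  have e2 := (hasSum_nat_add_iff' L).2 (hasSum_lerchPhi h0 h1 hs)
  have e3 := e1.unique (e2.congr_fun fun k => by
    rw [← hz, pow_add]
    push_cast
    ring)
  rw [← hz] at e3
  have e4 : ∑ k ∈ Finset.range L, z ^ k * ((k + 1 : ℕ) : ℂ) ^ (-s) =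
      ∑ k ∈ Finset.range L, z ^ k / ((k : ℂ) + 1) ^ s := by
    refine Finset.sum_congr rfl fun k _ => ?_
    rw [Complex.cpow_neg]
    push_cast
    ring
  rw [e4, ← e3, Complex.cpow_neg]
  ring

theorem exists_norm_lerchKernel_sub_le {θ : ℝ} (h0 : 0 < θ) (h1 : θ < 2 * Real.pi) :
    ∃ C : ℝ, 0 ≤ C ∧ ∀ u : ℝ, 0 < u → ‖lerchKernel (Complex.exp (Complex.I * θ)) u -
      lerchKernel (Complex.exp (Complex.I * θ)) 0‖ ≤ C * u := by
  refine ⟨1 / (2 * Real.pi) ^ 2 * (hurwitzSum 2 (θ / (2 * Real.pi)) +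
    hurwitzSum 2 (1 - θ / (2 * Real.pi))), ?_, fun u hu => ?_⟩
  · have hp := Real.two_pi_pos
    have hx : 0 ≤ 1 - θ / (2 * Real.pi) := by
      rw [sub_nonneg, div_le_one hp]; exact h1.le
    have hh : ∀ a : ℝ, 0 ≤ a → 0 ≤ hurwitzSum 2 a := fun a ha =>
      tsum_nonneg fun k => by positivity
    have := hh _ hx
    have := hh (θ / (2 * Real.pi)) (by positivity)
    positivity
  · have := (norm_lerchKernel_sub_taylor_lt h0 h1 hu 0).le
    simp only [Finset.range_zero, Finset.sum_empty, sub_zero, zero_add, pow_one] at this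
    rw [mul_comm u] at this
    exact this

/-- Subtracting K(0) makes the integrand vanish to first order at 0, which moves the boundary of
holomorphy from Re s = 0 to Re s = -1, so that s = 0 becomes an interior point. -/
theorem differentiableAt_mellin_lerchKernelDiff {θ : ℝ} (h0 : 0 < θ) (h1 : θ < 2 * Real.pi) {L : ℕ}
    (hL : 1 ≤ L) {s : ℂ} (hs : -1 < s.re) :
    DifferentiableAt ℂ (mellin (lerchKernelDiff (Complex.exp (Complex.I * θ)) L)) s := by
  obtain ⟨C, hC, hle⟩ := exists_norm_lerchKernel_sub_le h0 h1
  have hL' : (1 : ℝ) ≤ L := by exact_mod_cast hL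
  have hexp : ∀ u : ℝ, ‖Complex.exp (-((L : ℂ) * u))‖ = Real.exp (-(L * u)) := fun u => by
    rw [Complex.norm_exp]; simp
  -- The value b = -1 encodes the bound O(u) at 0. Of the decay e^{-u} guaranteed by L ≥ 1, one half
  -- absorbs the linear growth of C u and the other half remains as a = 1/2.
  refine mellin_differentiableAt_of_isBigO_rpow_exp (a := 1 / 2) (b := -1) (by norm_num) ?_ ?_ ?_ hs
  · refine ContinuousOn.locallyIntegrableOn ?_ measurableSet_Ioi
    unfold lerchKernelDiff
    refine ContinuousOn.mul (ContinuousOn.sub ?_ continuousOn_const) (by fun_prop)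
    exact (continuousOn_lerchKernel (norm_exp_I_mul θ) (exp_I_mul_ne_one h0 h1)).mono
      Set.Ioi_subset_Ici_self
  · refine Asymptotics.IsBigO.of_bound (2 * C) ?_
    filter_upwards [eventually_gt_atTop 0] with u hu
    rw [lerchKernelDiff, norm_mul, hexp, Real.norm_of_nonneg (Real.exp_pos _).le]
    have a1 : u / 2 ≤ Real.exp (u / 2) := by linarith [Real.add_one_le_exp (u / 2)]
    have a2 : Real.exp (-(L * u)) ≤ Real.exp (-(u / 2)) * Real.exp (-(1 / 2) * u) := by
      rw [← Real.exp_add]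
      apply Real.exp_le_exp.2
      nlinarith
    have a3 : u * Real.exp (-(u / 2)) ≤ 2 := by
      rw [Real.exp_neg, ← div_eq_mul_inv, div_le_iff₀ (Real.exp_pos _)]
      linarith
    calc _ ≤ C * u * (Real.exp (-(u / 2)) * Real.exp (-(1 / 2) * u)) :=
          mul_le_mul (hle u hu) a2 (Real.exp_pos _).le (by positivity)
      _ = C * Real.exp (-(1 / 2) * u) * (u * Real.exp (-(u / 2))) := by ring
      _ ≤ C * Real.exp (-(1 / 2) * u) * 2 := mul_le_mul_of_nonneg_left a3 (by positivity)
      _ = _ := by ring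
  · refine Asymptotics.IsBigO.of_bound C ?_
    filter_upwards [self_mem_nhdsWithin] with u hu
    have hu' : 0 < u := hu
    rw [lerchKernelDiff, norm_mul, hexp, neg_neg, Real.rpow_one, Real.norm_of_nonneg hu'.le]
    refine (mul_le_mul (hle u hu) (Real.exp_le_one_iff.2 ?_) (Real.exp_pos _).le
      (by positivity)).trans_eq (mul_one _)
    nlinarith

theorem mellin_lerchKernelDiff_of_neg_one_lt_re {θ : ℝ} (h0 : 0 < θ) (h1 : θ < 2 * Real.pi) {L : ℕ}
    (hL : 1 ≤ L) {s : ℂ} (hs : -1 < s.re) :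
    Complex.exp (Complex.I * θ) ^ L *
        (mellin (lerchKernelDiff (Complex.exp (Complex.I * θ)) L) s * (Complex.Gamma s)⁻¹) =
      lerchPhi (Complex.exp (Complex.I * θ)) s 1 -
        ∑ k ∈ Finset.range L, Complex.exp (Complex.I * θ) ^ k * ((k + 1 : ℕ) : ℂ) ^ (-s) -
        Complex.exp (Complex.I * θ) ^ L *
          (lerchKernel (Complex.exp (Complex.I * θ)) 0 * (L : ℂ) ^ (-s)) := by
  have hU : IsOpen {s : ℂ | -1 < s.re} := isOpen_lt continuous_const Complex.continuous_re
  have hLc : (L : ℂ) ≠ 0 := by exact_mod_cast (by omega : L ≠ 0)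
  refine AnalyticOnNhd.eqOn_of_preconnected_of_eventuallyEq (𝕜 := ℂ) (F := ℂ)
    (f := fun s : ℂ => Complex.exp (Complex.I * θ) ^ L *
        (mellin (lerchKernelDiff (Complex.exp (Complex.I * θ)) L) s * (Complex.Gamma s)⁻¹))
    (g := fun s : ℂ => lerchPhi (Complex.exp (Complex.I * θ)) s 1 -
        ∑ k ∈ Finset.range L, Complex.exp (Complex.I * θ) ^ k * ((k + 1 : ℕ) : ℂ) ^ (-s) -
        Complex.exp (Complex.I * θ) ^ L *
          (lerchKernel (Complex.exp (Complex.I * θ)) 0 * (L : ℂ) ^ (-s)))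
    (U := {s : ℂ | -1 < s.re}) (z₀ := 2) (DifferentiableOn.analyticOnNhd ?_ hU) (DifferentiableOn.analyticOnNhd ?_ hU)
    (convex_halfSpace_re_gt (-1)).isPreconnected (by norm_num) ?_ hs
  · intro w hw
    exact (((differentiableAt_mellin_lerchKernelDiff h0 h1 hL hw).mul
      Complex.differentiable_one_div_Gamma.differentiableAt).const_mul _).differentiableWithinAt
  · refine Differentiable.differentiableOn ?_
    refine ((differentiable_lerchPhi h0 h1).sub ?_).sub ?_
    · refine Differentiable.fun_sum fun k _ => Differentiable.const_mul ?_ _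
      exact Differentiable.const_cpow differentiable_id.neg
        (Or.inl (by exact_mod_cast Nat.succ_ne_zero k))
    · exact (Differentiable.const_cpow differentiable_id.neg (Or.inl hLc)).const_mul _ |>.const_mul _
  · filter_upwards [(isOpen_lt continuous_const Complex.continuous_re).mem_nhds
      (show (1 : ℝ) < (2 : ℂ).re by norm_num)] with s hs using mellin_lerchKernelDiff h0 h1 hL hs

theorem lerchPhi_zero {θ : ℝ} (h0 : 0 < θ) (h1 : θ < 2 * Real.pi) :
    lerchPhi (Complex.exp (Complex.I * θ)) 0 1 = lerchKernel (Complex.exp (Complex.I * θ)) 0 := by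
  have h := mellin_lerchKernelDiff_of_neg_one_lt_re h0 h1 le_rfl (s := 0) (by norm_num)
  have hz : 1 - Complex.exp (Complex.I * θ) ≠ 0 := sub_ne_zero.2 (exp_I_mul_ne_one h0 h1).symm
  -- The conventions `Complex.Gamma 0 = 0` and `0⁻¹ = 0` give the true value 0 of the entire
  -- function 1/Γ at 0. With L = 1 what is left is Φ(z,0,1) = 1 + z/(1 - z).
  simp only [Complex.Gamma_zero, inv_zero, mul_zero, pow_one, Finset.range_one,
    Finset.sum_singleton, pow_zero, neg_zero, Complex.cpow_zero, mul_one] at h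
  rw [lerchKernel_zero] at h ⊢
  field_simp at h ⊢
  linear_combination -h

theorem hasDerivAt_inv_Gamma_zero : HasDerivAt (fun s : ℂ => (Complex.Gamma s)⁻¹) 1 0 := by
  have h1 : HasDerivAt (fun s : ℂ => s * (Complex.Gamma (s + 1))⁻¹)
      (1 * (Complex.Gamma (0 + 1))⁻¹ + 0 * deriv (fun s : ℂ => (Complex.Gamma (s + 1))⁻¹) 0) 0 :=
    (hasDerivAt_id (0 : ℂ)).mul (DifferentiableAt.hasDerivAt
      (Complex.differentiable_one_div_Gamma.comp (differentiable_id.add_const 1)).differentiableAt)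
  simp only [zero_add, Complex.Gamma_one, inv_one, mul_one, zero_mul, add_zero] at h1
  exact h1.congr_of_eventuallyEq
    (Eventually.of_forall Complex.one_div_Gamma_eq_self_mul_one_div_Gamma_add_one)

theorem hasDerivAt_natCast_cpow_neg_zero {n : ℕ} (hn : n ≠ 0) :
    HasDerivAt (fun s : ℂ => (n : ℂ) ^ (-s)) (-(Real.log n : ℂ)) 0 := by
  have h := (hasDerivAt_id (0 : ℂ)).neg.const_cpow (c := (n : ℂ)) (Or.inl (by exact_mod_cast hn))
  simpa [Complex.natCast_log] using h

/-- Since 1/Γ vanishes at 0 with derivative 1, the product rule leaves the value of the Mellin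
transform at 0 and not its derivative. -/
theorem deriv_lerchPhi_zero {θ : ℝ} (h0 : 0 < θ) (h1 : θ < 2 * Real.pi) {L : ℕ} (hL : 1 ≤ L) :
    deriv (fun s => lerchPhi (Complex.exp (Complex.I * θ)) s 1) 0 +
        ∑ k ∈ Finset.range L, Complex.exp (Complex.I * θ) ^ k * (Real.log (k + 1 : ℕ) : ℂ) =
      Complex.exp (Complex.I * θ) ^ L *
        (mellin (lerchKernelDiff (Complex.exp (Complex.I * θ)) L) 0 -
          lerchKernel (Complex.exp (Complex.I * θ)) 0 * (Real.log L : ℂ)) := by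
  set z := Complex.exp (Complex.I * θ) with hz
  have hd := ((differentiableAt_mellin_lerchKernelDiff h0 h1 hL (s := 0) (by norm_num)).hasDerivAt.mul
    hasDerivAt_inv_Gamma_zero).const_mul (z ^ L)
  have hr := ((differentiable_lerchPhi h0 h1 0).hasDerivAt.sub
    (HasDerivAt.fun_sum fun k (_ : k ∈ Finset.range L) =>
      (hasDerivAt_natCast_cpow_neg_zero (Nat.succ_ne_zero k)).const_mul (z ^ k))).sub
    (((hasDerivAt_natCast_cpow_neg_zero (n := L) (by omega)).const_mul
      (lerchKernel z 0)).const_mul (z ^ L))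
  have he := hd.unique (hr.congr_of_eventuallyEq (by
    filter_upwards [(isOpen_lt continuous_const Complex.continuous_re).mem_nhds
      (show (-1 : ℝ) < (0 : ℂ).re by norm_num)] with s hs
    exact mellin_lerchKernelDiff_of_neg_one_lt_re h0 h1 hL hs))
  simp only [Complex.Gamma_zero, inv_zero, mul_zero, zero_add, mul_one, mul_neg,
    Finset.sum_neg_distrib, sub_neg_eq_add] at he
  simp only [Nat.succ_eq_add_one] at he
  linear_combination -he

/-! ### The remainder R and the expansion of the power sum -/

theorem integrableOn_pow_mul_exp_neg (m : ℕ) {x : ℝ} (hx : 0 < x) :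
    MeasureTheory.IntegrableOn (fun u : ℝ => u ^ m * Real.exp (-(x * u))) (Set.Ioi 0) := by
  have h := integrableOn_rpow_mul_exp_neg_mul_rpow (p := 1) (s := m) (b := x)
    (by linarith [(Nat.cast_nonneg m : (0 : ℝ) ≤ m)]) one_pos hx
  refine h.congr_fun (fun u _ => ?_) measurableSet_Ioi
  simp only [Real.rpow_natCast, Real.rpow_one, neg_mul]

theorem integral_pow_mul_exp_neg (m : ℕ) {x : ℝ} (hx : 0 < x) :
    ∫ u in Set.Ioi (0 : ℝ), u ^ m * Real.exp (-(x * u)) = m.factorial / x ^ (m + 1) := by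
  have h := Real.integral_rpow_mul_exp_neg_mul_Ioi (a := m + 1) (r := x) (by positivity) hx
  rw [Real.Gamma_nat_eq_factorial] at h
  have e : ∀ u : ℝ, u ^ ((m : ℝ) + 1 - 1) = u ^ m := fun u => by
    rw [add_sub_cancel_right, Real.rpow_natCast]
  simp only [e] at h
  rw [h, show (m : ℝ) + 1 = ((m + 1 : ℕ) : ℝ) by push_cast; ring, Real.rpow_natCast, one_div,
    inv_pow, ← div_eq_inv_mul]

/-- The Taylor remainder of order `n + 1` of the Lerch kernel. -/
noncomputable def lerchTail (z : ℂ) (n : ℕ) (u : ℝ) : ℂ :=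
  lerchKernel z u - lerchKernel z 0 -
    ∑ m ∈ Finset.range n, (-(u : ℂ)) ^ (m + 1) * lerchPhi z (-(m + 1 : ℕ)) 1 /
      ((m + 1).factorial : ℂ)

theorem norm_lerchTail_div_lt {θ : ℝ} (h0 : 0 < θ) (h1 : θ < 2 * Real.pi) {u : ℝ}
    (hu : 0 < u) (n L : ℕ) :
    ‖lerchTail (Complex.exp (Complex.I * θ)) n u / ((u : ℂ) * Complex.exp (L * u))‖ <
      (1 / (2 * Real.pi) ^ (n + 2) * (hurwitzSum (n + 2) (θ / (2 * Real.pi)) +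
        hurwitzSum (n + 2) (1 - θ / (2 * Real.pi)))) * (u ^ n * Real.exp (-(L * u))) := by
  have h := norm_lerchKernel_sub_taylor_lt h0 h1 hu n
  have he : ‖Complex.exp ((L : ℂ) * u)‖ = Real.exp (L * u) := by
    rw [Complex.norm_exp]; simp
  rw [norm_div, norm_mul, he, Complex.norm_real, Real.norm_of_nonneg hu.le, Real.exp_neg,
    div_lt_iff₀ (mul_pos hu (Real.exp_pos _))]
  refine h.trans_eq ?_
  have := Real.exp_ne_zero (L * u)
  rw [pow_succ]
  field_simp

theorem integrableOn_lerchTail_div {θ : ℝ} (h0 : 0 < θ) (h1 : θ < 2 * Real.pi) (n : ℕ) {L : ℕ}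
    (hL : 1 ≤ L) : MeasureTheory.IntegrableOn (fun u : ℝ =>
      lerchTail (Complex.exp (Complex.I * θ)) n u / ((u : ℂ) * Complex.exp (L * u)))
        (Set.Ioi 0) := by
  have hL' : (0 : ℝ) < L := by exact_mod_cast hL
  refine MeasureTheory.Integrable.mono' ((integrableOn_pow_mul_exp_neg n hL').const_mul _) ?_
    ((MeasureTheory.ae_restrict_iff' measurableSet_Ioi).2 (Eventually.of_forall fun u hu =>
      (norm_lerchTail_div_lt h0 h1 hu n L).le))
  refine ContinuousOn.aestronglyMeasurable ?_ measurableSet_Ioi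
  unfold lerchTail
  refine ContinuousOn.div (ContinuousOn.sub (ContinuousOn.sub ?_ continuousOn_const) (by fun_prop))
    (by fun_prop) fun u hu => ?_
  · exact (continuousOn_lerchKernel (norm_exp_I_mul θ) (exp_I_mul_ne_one h0 h1)).mono
      Set.Ioi_subset_Ici_self
  · exact mul_ne_zero (Complex.ofReal_ne_zero.2 (ne_of_gt hu)) (Complex.exp_ne_zero _)

/-- The summand m = 0 in the definition of R is Φ(z,0,1) = K(0), so R is the integral of the Taylor
remainder. With N = n+1 the quotient of factorials is N. -/
theorem lerchRemainder_eq {θ : ℝ} (h0 : 0 < θ) (h1 : θ < 2 * Real.pi) (n L : ℕ) :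
    lerchRemainder (Complex.exp (Complex.I * θ)) (n + 1) 1 0 L =
      (-(L : ℂ)) ^ (n + 1) * (n + 1) * ∫ u in Set.Ioi (0 : ℝ),
        lerchTail (Complex.exp (Complex.I * θ)) n u / ((u : ℂ) * Complex.exp (L * u)) := by
  have hf : (n.factorial : ℂ) ≠ 0 := by exact_mod_cast Nat.factorial_ne_zero _
  unfold lerchRemainder
  congr 1
  · simp only [Nat.sub_zero, Nat.add_sub_cancel, Nat.factorial_succ, Complex.ofReal_natCast]
    push_cast
    rw [neg_pow (L : ℂ)]
    field_simp
  · congr 1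
    ext u
    rw [if_neg (exp_I_mul_ne_one h0 h1), sub_zero, Finset.sum_range_succ', lerchTail,
      Nat.cast_one, one_mul, zero_add, pow_one, Complex.ofReal_natCast, ← lerchPhi_zero h0 h1]
    simp only [lerchKernel, pow_zero, Nat.cast_zero, neg_zero, Nat.factorial_zero, Nat.cast_one,
      div_one, one_mul]
    congr 1
    ring

/-- The pointwise bound is integrated against ∫ u^n e^{-Lu} du = n!/L^(n+1), which cancels the power
of L in R; hence the uniformity in L. -/
theorem norm_lerchRemainder_lt {θ : ℝ} (h0 : 0 < θ) (h1 : θ < 2 * Real.pi) (n : ℕ) {L : ℕ}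
    (hL : 1 ≤ L) :
    ‖lerchRemainder (Complex.exp (Complex.I * θ)) (n + 1) 1 0 L‖ <
      ((n + 1).factorial : ℝ) / (2 * Real.pi) ^ (n + 2) *
        (hurwitzSum (n + 2) (θ / (2 * Real.pi)) + hurwitzSum (n + 2) (1 - θ / (2 * Real.pi))) := by
  have hL' : (0 : ℝ) < L := by exact_mod_cast hL
  set C : ℝ := 1 / (2 * Real.pi) ^ (n + 2) * (hurwitzSum (n + 2) (θ / (2 * Real.pi)) +
        hurwitzSum (n + 2) (1 - θ / (2 * Real.pi))) with hC
  set T : ℝ → ℂ := fun u =>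
    lerchTail (Complex.exp (Complex.I * θ)) n u / ((u : ℂ) * Complex.exp (L * u)) with hT
  have hlt : ∀ u ∈ Set.Ioi (0 : ℝ), ‖T u‖ < C * (u ^ n * Real.exp (-(L * u))) :=
    fun u hu => norm_lerchTail_div_lt h0 h1 hu n L
  have hintg : MeasureTheory.IntegrableOn (fun u => ‖T u‖) (Set.Ioi 0) :=
    (integrableOn_lerchTail_div h0 h1 n hL).norm
  have hintg' : MeasureTheory.IntegrableOn (fun u : ℝ => C * (u ^ n * Real.exp (-(L * u))))
    (Set.Ioi 0) := (integrableOn_pow_mul_exp_neg n hL').const_mul C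
  -- Strictness survives integration because the gap is positive on all of (0, ∞), a set of positive
  -- measure.
  have hpos : 0 < ∫ u in Set.Ioi (0 : ℝ), (C * (u ^ n * Real.exp (-(L * u))) - ‖T u‖) := by
    rw [MeasureTheory.setIntegral_pos_iff_support_of_nonneg_ae
      ((MeasureTheory.ae_restrict_iff' measurableSet_Ioi).2 (Eventually.of_forall fun u hu =>
        (sub_pos.2 (hlt u hu)).le)) (hintg'.sub hintg)]
    have hsub : Set.Ioi (0 : ℝ) ⊆
        Function.support fun u => C * (u ^ n * Real.exp (-(L * u))) - ‖T u‖ :=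
      fun u hu => (sub_pos.2 (hlt u hu)).ne'
    rw [Set.inter_eq_right.2 hsub]
    simp
  rw [MeasureTheory.integral_sub hintg' hintg, sub_pos, MeasureTheory.integral_const_mul,
    integral_pow_mul_exp_neg n hL'] at hpos
  have hle : ‖∫ u in Set.Ioi (0 : ℝ), T u‖ ≤ ∫ u in Set.Ioi (0 : ℝ), ‖T u‖ :=
    MeasureTheory.norm_integral_le_integral_norm _
  rw [lerchRemainder_eq h0 h1, norm_mul, norm_mul, norm_pow, norm_neg, Complex.norm_natCast]
  have hn : ‖(n : ℂ) + 1‖ = n + 1 := by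
    rw [← Nat.cast_add_one, Complex.norm_natCast]; push_cast; rfl
  rw [hn]
  calc _ < (L : ℝ) ^ (n + 1) * (n + 1) * (C * (n.factorial / (L : ℝ) ^ (n + 1))) :=
        mul_lt_mul_of_pos_left (hle.trans_lt hpos) (by positivity)
    _ = _ := by
        rw [hC, Nat.factorial_succ]
        push_cast
        field_simp

/-- Termwise integration: the Taylor term of degree m+1, divided by u, integrates with m!/L^(m+1),
and m!/(m+1)! = 1/(m+1). -/
theorem mellin_lerchKernelDiff_zero {θ : ℝ} (h0 : 0 < θ) (h1 : θ < 2 * Real.pi) (n : ℕ) {L : ℕ}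
    (hL : 1 ≤ L) :
    mellin (lerchKernelDiff (Complex.exp (Complex.I * θ)) L) 0 =
      ∑ m ∈ Finset.range n, ((-(L : ℂ)) ^ (m + 1))⁻¹ / ((m + 1 : ℕ) : ℂ) *
          lerchPhi (Complex.exp (Complex.I * θ)) (-(m + 1 : ℕ)) 1 +
        ((-(L : ℂ)) ^ (n + 1))⁻¹ / ((n + 1 : ℕ) : ℂ) *
          lerchRemainder (Complex.exp (Complex.I * θ)) (n + 1) 1 0 L := by
  have hL' : (0 : ℝ) < L := by exact_mod_cast hL
  have hLc : (L : ℂ) ≠ 0 := by exact_mod_cast (by omega : L ≠ 0)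
  set z := Complex.exp (Complex.I * θ) with hz
  let c : ℕ → ℂ := fun m => (-1) ^ (m + 1) * lerchPhi z (-(m + 1 : ℕ)) 1 / ((m + 1).factorial : ℂ)
  have hpow : ∀ m : ℕ, MeasureTheory.IntegrableOn
      (fun u : ℝ => c m * ((u ^ m * Real.exp (-(L * u)) : ℝ) : ℂ)) (Set.Ioi 0) := fun m =>
    (integrableOn_pow_mul_exp_neg m hL').ofReal.const_mul _
  have hsplit : ∀ u ∈ Set.Ioi (0 : ℝ), (u : ℂ) ^ ((0 : ℂ) - 1) • lerchKernelDiff z L u =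
      ∑ m ∈ Finset.range n, c m * ((u ^ m * Real.exp (-(L * u)) : ℝ) : ℂ) +
        lerchTail z n u / ((u : ℂ) * Complex.exp (L * u)) := by
    intro u hu
    have hu' : (u : ℂ) ≠ 0 := Complex.ofReal_ne_zero.2 (ne_of_gt hu)
    rw [zero_sub, Complex.cpow_neg_one, smul_eq_mul, lerchKernelDiff, lerchTail, Complex.exp_neg,
      sub_div, Finset.sum_div]
    have hsum : ∑ m ∈ Finset.range n, (-(u : ℂ)) ^ (m + 1) * lerchPhi z (-(m + 1 : ℕ)) 1 /
        ((m + 1).factorial : ℂ) / ((u : ℂ) * Complex.exp (L * u)) =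
        ∑ m ∈ Finset.range n, c m * ((u ^ m * Real.exp (-(L * u)) : ℝ) : ℂ) := by
      refine Finset.sum_congr rfl fun m _ => ?_
      simp only [c]
      push_cast
      rw [neg_pow (u : ℂ), Complex.exp_neg]
      have := Complex.exp_ne_zero ((L : ℂ) * u)
      field_simp
      ring
    rw [hsum, add_sub_cancel, div_mul_eq_div_div, div_eq_mul_inv _ (Complex.exp _), div_eq_inv_mul,
      mul_assoc]
  rw [mellin, MeasureTheory.setIntegral_congr_fun measurableSet_Ioi hsplit,
    MeasureTheory.integral_add (MeasureTheory.integrable_finsetSum _ fun m _ => hpow m)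
      (integrableOn_lerchTail_div h0 h1 n hL),
    MeasureTheory.integral_finsetSum _ fun m _ => hpow m, lerchRemainder_eq h0 h1]
  congr 1
  · refine Finset.sum_congr rfl fun m _ => ?_
    rw [MeasureTheory.integral_const_mul, integral_complex_ofReal, integral_pow_mul_exp_neg m hL']
    have hf : (m.factorial : ℂ) ≠ 0 := by exact_mod_cast Nat.factorial_ne_zero _
    have hm : (m : ℂ) + 1 ≠ 0 := by exact_mod_cast Nat.succ_ne_zero m
    simp only [c, Nat.factorial_succ]
    push_cast
    rw [neg_pow (L : ℂ), mul_inv, ← inv_pow, show (-1 : ℂ)⁻¹ = -1 by norm_num]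
    field_simp
  · have hm : (n : ℂ) + 1 ≠ 0 := by exact_mod_cast Nat.succ_ne_zero n
    have hp : (-(L : ℂ)) ^ (n + 1) ≠ 0 := pow_ne_zero _ (neg_ne_zero.2 hLc)
    push_cast
    rw [← mul_assoc, div_mul_eq_mul_div, inv_mul_cancel_left₀ hp, div_self hm, one_mul]

theorem sum_Icc_one_eq_sum_range {M : Type*} [AddCommMonoid M] (N : ℕ) (f : ℕ → M) :
    ∑ k ∈ Finset.Icc 1 N, f k = ∑ k ∈ Finset.range N, f (k + 1) := by
  rw [Finset.range_eq_Ico, Finset.sum_Ico_add' f 0 N 1]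
  rfl

/-- The asymptotic expansion of `∑ z ^ k log k` on the unit circle with its exact remainder. -/
theorem sum_pow_mul_log {θ : ℝ} (h0 : 0 < θ) (h1 : θ < 2 * Real.pi) (n : ℕ) {L : ℕ}
    (hL : 1 ≤ L) :
    ∑ k ∈ Finset.Icc 1 L, Complex.exp (Complex.I * θ) ^ k * (Real.log k : ℂ) =
      -(Complex.exp (Complex.I * θ) *
        deriv (fun s => lerchPhi (Complex.exp (Complex.I * θ)) s 1) 0) +
      Complex.exp (Complex.I * θ) ^ (L + 1) *
        (∑ m ∈ Finset.Icc 1 n, ((-(L : ℂ)) ^ m)⁻¹ / (m : ℂ) *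
            lerchPhi (Complex.exp (Complex.I * θ)) (-m) 1 +
          ((-(L : ℂ)) ^ (n + 1))⁻¹ / ((n + 1 : ℕ) : ℂ) *
            lerchRemainder (Complex.exp (Complex.I * θ)) (n + 1) 1 0 L -
          1 / (1 - Complex.exp (Complex.I * θ)) * (Real.log L : ℂ)) := by
  have h := deriv_lerchPhi_zero h0 h1 hL
  rw [mellin_lerchKernelDiff_zero h0 h1 n hL, lerchKernel_zero] at h
  rw [sum_Icc_one_eq_sum_range, sum_Icc_one_eq_sum_range]
  have e : ∑ k ∈ Finset.range L, Complex.exp (Complex.I * θ) ^ (k + 1) *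
      (Real.log (k + 1 : ℕ) : ℂ) = Complex.exp (Complex.I * θ) *
      ∑ k ∈ Finset.range L, Complex.exp (Complex.I * θ) ^ k * (Real.log (k + 1 : ℕ) : ℂ) := by
    rw [Finset.mul_sum]
    exact Finset.sum_congr rfl fun k _ => by ring
  rw [e]
  linear_combination Complex.exp (Complex.I * θ) * h

/-! ### The logarithmic sum for real t -/

/-- Reduction modulo 2π: e^{it} and e^{-it} belong to the angles θ and 2π - θ, both in (0, 2π). As
{θ, 2π - θ} = {|t|, 2π - |t|}, the symmetric bound for R depends only on |t|. -/
theorem exists_exp_I_mul_eq {t : ℝ} (ht0 : t ≠ 0) (ht : |t| < 2 * Real.pi) :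
    ∃ θ : ℝ, 0 < θ ∧ θ < 2 * Real.pi ∧ Complex.exp (Complex.I * t) = Complex.exp (Complex.I * θ) ∧
      Complex.exp (-(Complex.I * t)) = Complex.exp (Complex.I * (2 * Real.pi - θ : ℝ)) ∧
      (θ = |t| ∨ θ = 2 * Real.pi - |t|) := by
  have hper : ∀ w : ℂ, Complex.exp (w + 2 * Real.pi * Complex.I) = Complex.exp w :=
    Complex.exp_periodic
  rcases lt_or_gt_of_ne ht0 with h | h
  · rw [abs_of_neg h] at ht ⊢
    refine ⟨2 * Real.pi + t, by linarith, by linarith, ?_, ?_, Or.inr (by ring)⟩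
    · rw [← hper]; congr 1; push_cast; ring
    · congr 1; push_cast; ring
  · rw [abs_of_pos h] at ht ⊢
    refine ⟨t, h, ht, rfl, ?_, Or.inl rfl⟩
    rw [← hper]; congr 1; push_cast; ring

/-- Euler's formula writes the sine sum as e^{-iLt/2} ∑ z^k log k minus its counterpart at e^{-it};
`sum_pow_mul_log` applies to each. -/
theorem log_sum_expansion {t : ℝ} (ht0 : t ≠ 0) (ht : |t| < 2 * Real.pi) {N L : ℕ} (hN : 1 ≤ N)
    (hL : 1 ≤ L) :
    ((∑ k ∈ Finset.Icc 1 L,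
          Real.sin ((2 * (k : ℝ) - L) * t / 2) / Real.sin (t / 2) * Real.log k : ℝ) : ℂ) =
        ((-(Real.cos (((L : ℝ) + 1) * t / 2) / (2 * Real.sin (t / 2) ^ 2)) * Real.log L : ℝ) : ℂ)
        - 1 / (2 * Complex.I * Complex.sin (t / 2)) *
            (Complex.exp (-(Complex.I * ((L : ℂ) - 2) * t / 2)) *
                deriv (fun s : ℂ => lerchPhi (Complex.exp (Complex.I * t)) s 1) 0
              - Complex.exp (Complex.I * ((L : ℂ) - 2) * t / 2) *
                deriv (fun s : ℂ => lerchPhi (Complex.exp (-(Complex.I * t))) s 1) 0)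
        + 1 / (2 * Complex.I * Complex.sin (t / 2)) *
            ∑ m ∈ Finset.Icc 1 (N - 1), ((-(L : ℂ)) ^ m)⁻¹ / m *
              (Complex.exp (Complex.I * ((L : ℂ) + 2) * t / 2) *
                  lerchPhi (Complex.exp (Complex.I * t)) (-m) 1
                - Complex.exp (-(Complex.I * ((L : ℂ) + 2) * t / 2)) *
                  lerchPhi (Complex.exp (-(Complex.I * t))) (-m) 1)
        + 1 / (2 * Complex.I * Complex.sin (t / 2)) * (((-(L : ℂ)) ^ N)⁻¹ / N) *
            (Complex.exp (Complex.I * ((L : ℂ) + 2) * t / 2) *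
                lerchRemainder (Complex.exp (Complex.I * t)) N 1 0 L
              - Complex.exp (-(Complex.I * ((L : ℂ) + 2) * t / 2)) *
                lerchRemainder (Complex.exp (-(Complex.I * t))) N 1 0 L) := by
  obtain ⟨n, rfl⟩ : ∃ n, N = n + 1 := ⟨N - 1, by omega⟩
  obtain ⟨θ, h0, h1, hz, hw, -⟩ := exists_exp_I_mul_eq ht0 ht
  have Sz := sum_pow_mul_log h0 h1 n hL
  have Sw := sum_pow_mul_log (θ := 2 * Real.pi - θ) (by linarith) (by linarith) n hL
  have z1 := exp_I_mul_ne_one h0 h1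
  have w1 := exp_I_mul_ne_one (θ := 2 * Real.pi - θ) (by linarith) (by linarith)
  rw [← hz] at Sz z1
  rw [← hw] at Sw w1
  rw [Nat.add_sub_cancel]
  -- All exponentials become monomials in a, b = 1/a, A = e^{iLt/2} and B = 1/A, so that what
  -- remains is algebra modulo ab = 1 and AB = 1.
  set a := Complex.exp (Complex.I * t / 2) with ha
  set b := Complex.exp (-(Complex.I * t / 2)) with hb
  have hab : a * b = 1 := by rw [ha, hb, ← Complex.exp_add, add_neg_cancel, Complex.exp_zero]
  set A := Complex.exp (Complex.I * L * t / 2) with hA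
  set B := Complex.exp (-(Complex.I * L * t / 2)) with hB
  have hAB : A * B = 1 := by rw [hA, hB, ← Complex.exp_add, add_neg_cancel, Complex.exp_zero]
  have e1 : Complex.exp (-(Complex.I * ((L : ℂ) - 2) * t / 2)) = B * a ^ 2 := by
    rw [hB, ha, ← Complex.exp_nat_mul, ← Complex.exp_add]; congr 1; push_cast; ring
  have e2 : Complex.exp (Complex.I * ((L : ℂ) - 2) * t / 2) = A * b ^ 2 := by
    rw [hA, hb, ← Complex.exp_nat_mul, ← Complex.exp_add]; congr 1; push_cast; ring
  have e3 : Complex.exp (Complex.I * ((L : ℂ) + 2) * t / 2) = A * a ^ 2 := by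
    rw [hA, ha, ← Complex.exp_nat_mul, ← Complex.exp_add]; congr 1; push_cast; ring
  have e4 : Complex.exp (-(Complex.I * ((L : ℂ) + 2) * t / 2)) = B * b ^ 2 := by
    rw [hB, hb, ← Complex.exp_nat_mul, ← Complex.exp_add]; congr 1; push_cast; ring
  have e5 : Complex.exp (Complex.I * t) = a ^ 2 := by
    rw [ha, ← Complex.exp_nat_mul]; congr 1; push_cast; ring
  have e6 : Complex.exp (-(Complex.I * t)) = b ^ 2 := by
    rw [hb, ← Complex.exp_nat_mul]; congr 1; push_cast; ring
  have e7 : (a ^ 2) ^ (L + 1) = A ^ 2 * a ^ 2 := by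
    rw [hA, ha, ← Complex.exp_nat_mul, ← Complex.exp_nat_mul, ← Complex.exp_nat_mul,
      ← Complex.exp_add]; congr 1; push_cast; ring
  have e8 : (b ^ 2) ^ (L + 1) = B ^ 2 * b ^ 2 := by
    rw [hB, hb, ← Complex.exp_nat_mul, ← Complex.exp_nat_mul, ← Complex.exp_nat_mul,
      ← Complex.exp_add]; congr 1; push_cast; ring
  have hsin : 2 * Complex.I * Complex.sin (t / 2) = a - b := by
    rw [Complex.sin, ha, hb, show -((t : ℂ) / 2) * Complex.I = -(Complex.I * t / 2) by ring,
      show ((t : ℂ) / 2) * Complex.I = Complex.I * t / 2 by ring]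
    linear_combination (Complex.exp (-(Complex.I * t / 2)) - Complex.exp (Complex.I * t / 2)) *
      Complex.I_sq
  have hcos : ((Real.cos (((L : ℝ) + 1) * t / 2) : ℝ) : ℂ) = (A * a + B * b) / 2 := by
    rw [Complex.ofReal_cos, Complex.cos, hA, ha, hB, hb, ← Complex.exp_add, ← Complex.exp_add]
    congr 3
    · push_cast; ring
    · push_cast; ring
  have hterm : ∀ k : ℕ, 2 * Complex.I * ((Real.sin ((2 * (k : ℝ) - L) * t / 2) : ℝ) : ℂ) =
      B * (a ^ 2) ^ k - A * (b ^ 2) ^ k := by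
    intro k
    have p1 : B * (a ^ 2) ^ k = Complex.exp ((2 * (k : ℂ) - L) * t / 2 * Complex.I) := by
      rw [hB, ha, ← Complex.exp_nat_mul, ← Complex.exp_nat_mul, ← Complex.exp_add]
      congr 1; push_cast; ring
    have p2 : A * (b ^ 2) ^ k = Complex.exp (-((2 * (k : ℂ) - L) * t / 2) * Complex.I) := by
      rw [hA, hb, ← Complex.exp_nat_mul, ← Complex.exp_nat_mul, ← Complex.exp_add]
      congr 1; push_cast; ring
    rw [p1, p2, Complex.ofReal_sin, Complex.sin]
    push_cast
    linear_combination (Complex.exp (-((2 * (k : ℂ) - L) * t / 2) * Complex.I) -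
      Complex.exp ((2 * (k : ℂ) - L) * t / 2 * Complex.I)) * Complex.I_sq
  have a0 : a ≠ 0 := Complex.exp_ne_zero _
  have b0 : b ≠ 0 := Complex.exp_ne_zero _
  rw [e5] at Sz z1 ⊢
  rw [e6] at Sw w1 ⊢
  have hσ : a - b ≠ 0 := by
    intro h
    apply z1
    rw [sq]
    nth_rewrite 2 [sub_eq_zero.1 h]
    exact hab
  have hlhs : ((∑ k ∈ Finset.Icc 1 L,
      Real.sin ((2 * (k : ℝ) - L) * t / 2) / Real.sin (t / 2) * Real.log k : ℝ) : ℂ) =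
      1 / (a - b) * (B * ∑ k ∈ Finset.Icc 1 L, (a ^ 2) ^ k * (Real.log k : ℂ) -
        A * ∑ k ∈ Finset.Icc 1 L, (b ^ 2) ^ k * (Real.log k : ℂ)) := by
    rw [Finset.mul_sum, Finset.mul_sum, ← Finset.sum_sub_distrib, Finset.mul_sum,
      Complex.ofReal_sum]
    refine Finset.sum_congr rfl fun k _ => ?_
    rw [← mul_assoc, ← mul_assoc, ← sub_mul, ← hterm, ← hsin]
    push_cast
    have : (2 : ℂ) * Complex.I ≠ 0 := mul_ne_zero two_ne_zero Complex.I_ne_zero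
    rw [← mul_assoc, one_div_mul_eq_div, mul_div_mul_left _ _ this]
  have hlog : ((-(Real.cos (((L : ℝ) + 1) * t / 2) / (2 * Real.sin (t / 2) ^ 2)) *
      Real.log L : ℝ) : ℂ) = (A * a + B * b) / (a - b) ^ 2 * (Real.log L : ℂ) := by
    rw [Complex.ofReal_mul, Complex.ofReal_neg, Complex.ofReal_div, hcos, ← hsin]
    push_cast
    rw [mul_pow, mul_pow, Complex.I_sq]
    ring
  have hz' : 1 / (1 - a ^ 2) = -(b / (a - b)) := by
    rw [← neg_div, div_eq_div_iff (sub_ne_zero.2 z1.symm) hσ]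
    linear_combination -a * hab
  have hw' : 1 / (1 - b ^ 2) = a / (a - b) := by
    rw [div_eq_div_iff (sub_ne_zero.2 w1.symm) hσ]
    linear_combination b * hab
  have hsum : ∑ m ∈ Finset.Icc 1 n, ((-(L : ℂ)) ^ m)⁻¹ / m *
      (A * a ^ 2 * lerchPhi (a ^ 2) (-m) 1 - B * b ^ 2 * lerchPhi (b ^ 2) (-m) 1) =
      A * a ^ 2 * ∑ m ∈ Finset.Icc 1 n, ((-(L : ℂ)) ^ m)⁻¹ / m * lerchPhi (a ^ 2) (-m) 1 -
      B * b ^ 2 * ∑ m ∈ Finset.Icc 1 n, ((-(L : ℂ)) ^ m)⁻¹ / m * lerchPhi (b ^ 2) (-m) 1 := by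
    rw [Finset.mul_sum, Finset.mul_sum, ← Finset.sum_sub_distrib]
    exact Finset.sum_congr rfl fun m _ => by ring
  rw [hlhs, hlog, hsin, e1, e2, e3, e4, Sz, Sw, e7, e8, hsum, hz', hw']
  generalize ∑ m ∈ Finset.Icc 1 n, ((-(L : ℂ)) ^ m)⁻¹ / m * lerchPhi (a ^ 2) (-m) 1 = P
  generalize ∑ m ∈ Finset.Icc 1 n, ((-(L : ℂ)) ^ m)⁻¹ / m * lerchPhi (b ^ 2) (-m) 1 = Q
  generalize lerchRemainder (a ^ 2) (n + 1) 1 0 L = R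
  generalize lerchRemainder (b ^ 2) (n + 1) 1 0 L = R'
  generalize ((-(L : ℂ)) ^ (n + 1))⁻¹ / ((n + 1 : ℕ) : ℂ) = r
  generalize deriv (fun s => lerchPhi (a ^ 2) s 1) 0 = d
  generalize deriv (fun s => lerchPhi (b ^ 2) s 1) 0 = d'
  generalize (Real.log L : ℂ) = l
  have s1 : B * (A ^ 2 * a ^ 2 * (P + r * R - -(b / (a - b)) * l)) =
      A * a ^ 2 * (P + r * R) + A * a * l / (a - b) := by
    linear_combination (A * a ^ 2 * (P + r * R + b / (a - b) * l)) * hAB +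
      A * a * l / (a - b) * hab
  have s2 : A * (B ^ 2 * b ^ 2 * (Q + r * R' - a / (a - b) * l)) =
      B * b ^ 2 * (Q + r * R') - B * b * l / (a - b) := by
    linear_combination (B * b ^ 2 * (Q + r * R' - a / (a - b) * l)) * hAB -
      B * b * l / (a - b) * hab
  rw [mul_add B, mul_add A, s1, s2]
  field_simp
  ring

theorem remainder_bounds {t : ℝ} (ht0 : t ≠ 0) (ht : |t| < 2 * Real.pi) {N L : ℕ} (hN : 1 ≤ N)
    (hL : 1 ≤ L) :
    ‖lerchRemainder (Complex.exp (Complex.I * t)) N 1 0 L‖ <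
        (N.factorial : ℝ) / (2 * Real.pi) ^ (N + 1) *
          (hurwitzSum (N + 1) (|t| / (2 * Real.pi)) +
            hurwitzSum (N + 1) (1 - |t| / (2 * Real.pi))) ∧
      ‖lerchRemainder (Complex.exp (-(Complex.I * t))) N 1 0 L‖ <
        (N.factorial : ℝ) / (2 * Real.pi) ^ (N + 1) *
          (hurwitzSum (N + 1) (|t| / (2 * Real.pi)) +
            hurwitzSum (N + 1) (1 - |t| / (2 * Real.pi))) := by
  obtain ⟨n, rfl⟩ : ∃ n, N = n + 1 := ⟨N - 1, by omega⟩
  obtain ⟨θ, h0, h1, hz, hw, hθ⟩ := exists_exp_I_mul_eq ht0 ht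
  have b1 := norm_lerchRemainder_lt h0 h1 n hL
  have b2 := norm_lerchRemainder_lt (θ := 2 * Real.pi - θ) (by linarith) (by linarith) n hL
  have hp := Real.two_pi_pos.ne'
  rw [hz, hw]
  rw [sub_div, div_self hp, sub_sub_cancel, add_comm (hurwitzSum _ (1 - _))] at b2
  have hsymm : hurwitzSum (n + 2) (|t| / (2 * Real.pi)) +
      hurwitzSum (n + 2) (1 - |t| / (2 * Real.pi)) = hurwitzSum (n + 2) (θ / (2 * Real.pi)) +
      hurwitzSum (n + 2) (1 - θ / (2 * Real.pi)) := by
    rcases hθ with h | h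
    · rw [h]
    · rw [h, sub_div, div_self hp, sub_sub_cancel, add_comm]
  rw [show n + 1 + 1 = n + 2 from rfl, hsymm]
  exact ⟨b1, b2⟩

/-! ### Laplace transforms of u^j/(1+u^2): recursion, expansion, behaviour at 0 -/

/-- The Laplace transform of `u ^ j / (1 + u ^ 2)`. -/
noncomputable def laplaceAux (j : ℕ) (x : ℝ) : ℝ :=
  ∫ u in Set.Ioi (0 : ℝ), u ^ j * Real.exp (-(x * u)) / (1 + u ^ 2)

theorem continuous_laplaceAux_integrand (j : ℕ) (x : ℝ) :
    Continuous fun u : ℝ => u ^ j * Real.exp (-(x * u)) / (1 + u ^ 2) := by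
  refine Continuous.div (by fun_prop) (by fun_prop) fun u => by positivity

theorem laplaceAux_integrand_le (j : ℕ) (x : ℝ) {u : ℝ} (hu : 0 < u) :
    u ^ j * Real.exp (-(x * u)) / (1 + u ^ 2) ≤ u ^ j * Real.exp (-(x * u)) :=
  div_le_self (by positivity) (by nlinarith [sq_nonneg u])

theorem integrableOn_laplaceAux (j : ℕ) {x : ℝ} (hx : 0 < x) : MeasureTheory.IntegrableOn
    (fun u : ℝ => u ^ j * Real.exp (-(x * u)) / (1 + u ^ 2)) (Set.Ioi 0) := by
  refine MeasureTheory.Integrable.mono' (integrableOn_pow_mul_exp_neg j hx)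
    (continuous_laplaceAux_integrand j x).aestronglyMeasurable
    ((MeasureTheory.ae_restrict_iff' measurableSet_Ioi).2 (Eventually.of_forall fun u hu => ?_))
  have hu' : 0 < u := hu
  rw [Real.norm_of_nonneg (by positivity)]
  exact laplaceAux_integrand_le j x hu

theorem abs_laplaceAux_le (j : ℕ) {x : ℝ} (hx : 0 < x) :
    |laplaceAux j x| ≤ j.factorial / x ^ (j + 1) := by
  rw [← integral_pow_mul_exp_neg j hx, abs_of_nonneg]
  · exact MeasureTheory.setIntegral_mono_on (integrableOn_laplaceAux j hx)
      (integrableOn_pow_mul_exp_neg j hx) measurableSet_Ioi fun u hu => laplaceAux_integrand_le j x hu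
  · refine MeasureTheory.setIntegral_nonneg measurableSet_Ioi fun u hu => ?_
    have hu' : 0 < u := hu
    positivity

/-- From u^(j+2) + u^j = u^j (1 + u^2). Iterated, it gives the asymptotic expansion; combined with
`hasDerivAt_laplaceAux`, it gives the differential equations behind the sine and cosine integrals.
-/
theorem laplaceAux_add_two (j : ℕ) {x : ℝ} (hx : 0 < x) :
    laplaceAux (j + 2) x = j.factorial / x ^ (j + 1) - laplaceAux j x := by
  rw [eq_sub_iff_add_eq, laplaceAux, laplaceAux,
    ← MeasureTheory.integral_add (integrableOn_laplaceAux _ hx) (integrableOn_laplaceAux _ hx),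
    ← integral_pow_mul_exp_neg j hx]
  congr 1
  ext u
  have : (1 : ℝ) + u ^ 2 ≠ 0 := by positivity
  field_simp
  ring

theorem laplaceAux_eq_sum_add (j M : ℕ) {x : ℝ} (hx : 0 < x) :
    laplaceAux j x = ∑ m ∈ Finset.range M, (-1) ^ m * ((2 * m + j).factorial : ℝ) /
      x ^ (2 * m + j + 1) + (-1) ^ M * laplaceAux (2 * M + j) x := by
  induction M with
  | zero => simp
  | succ M ih =>
    rw [ih, Finset.sum_range_succ, show 2 * (M + 1) + j = 2 * M + j + 2 by ring,
      laplaceAux_add_two _ hx]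
    ring

theorem hasDerivAt_laplaceAux (j : ℕ) {x : ℝ} (hx : 0 < x) :
    HasDerivAt (laplaceAux j) (-laplaceAux (j + 1) x) x := by
  have h := (hasDerivAt_integral_of_dominated_loc_of_deriv_le (𝕜 := ℝ)
    (μ := MeasureTheory.volume.restrict (Set.Ioi (0 : ℝ)))
    (F := fun x u => u ^ j * Real.exp (-(x * u)) / (1 + u ^ 2))
    (F' := fun x u => -(u ^ (j + 1) * Real.exp (-(x * u)) / (1 + u ^ 2)))
    (bound := fun u => u ^ (j + 1) * Real.exp (-(x / 2 * u)))
    (s := Set.Ioi (x / 2)) (x₀ := x) (Ioi_mem_nhds (by linarith))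
    (Eventually.of_forall fun y => (continuous_laplaceAux_integrand j y).aestronglyMeasurable)
    (integrableOn_laplaceAux j hx)
    (continuous_laplaceAux_integrand (j + 1) x).neg.aestronglyMeasurable ?_
    (integrableOn_pow_mul_exp_neg (j + 1) (by linarith)) ?_).2
  · rwa [MeasureTheory.integral_neg] at h
  · refine (MeasureTheory.ae_restrict_iff' measurableSet_Ioi).2 (Eventually.of_forall fun u hu => ?_)
    intro y hy
    have hu' : 0 < u := hu
    have hy' : x / 2 < y := hy
    rw [norm_neg, Real.norm_of_nonneg (by positivity)]
    refine (laplaceAux_integrand_le _ _ hu').trans ?_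
    gcongr
  · refine (MeasureTheory.ae_restrict_iff' measurableSet_Ioi).2 (Eventually.of_forall fun u hu => ?_)
    intro y hy
    have h1 : HasDerivAt (fun y : ℝ => Real.exp (-(y * u))) (Real.exp (-(y * u)) * (-(1 * u))) y :=
      ((hasDerivAt_id y).mul_const u).neg.exp
    refine ((h1.const_mul (u ^ j)).div_const (1 + u ^ 2)).congr_deriv ?_
    ring

theorem tendsto_laplaceAux_zero :
    Tendsto (laplaceAux 0) (𝓝[>] 0) (𝓝 (Real.pi / 2)) := by
  have h := MeasureTheory.tendsto_integral_filter_of_dominated_convergence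
    (μ := MeasureTheory.volume.restrict (Set.Ioi (0 : ℝ))) (l := 𝓝[>] (0 : ℝ))
    (F := fun x u => u ^ 0 * Real.exp (-(x * u)) / (1 + u ^ 2)) (f := fun u : ℝ => (1 + u ^ 2)⁻¹)
    (fun u => (1 + u ^ 2)⁻¹)
    (Eventually.of_forall fun y => (continuous_laplaceAux_integrand 0 y).aestronglyMeasurable)
    ?_ integrable_inv_one_add_sq.integrableOn ?_
  · rw [integral_Ioi_inv_one_add_sq, Real.arctan_zero, sub_zero] at h
    exact h
  · filter_upwards [self_mem_nhdsWithin] with x hx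
    refine (MeasureTheory.ae_restrict_iff' measurableSet_Ioi).2 (Eventually.of_forall fun u hu => ?_)
    have hu' : 0 < u := hu
    have hx' : 0 < x := hx
    rw [Real.norm_of_nonneg (by positivity), pow_zero, one_mul, div_eq_mul_inv]
    exact mul_le_of_le_one_left (by positivity) (Real.exp_le_one_iff.2 (by nlinarith))
  · refine Eventually.of_forall fun u => ?_
    have hc : Continuous fun x : ℝ => u ^ 0 * Real.exp (-(x * u)) / (1 + u ^ 2) := by fun_prop
    have := hc.tendsto 0
    simp only [zero_mul, neg_zero, Real.exp_zero, pow_zero, mul_one, one_div] at this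
    simpa using this.mono_left nhdsWithin_le_nhds

theorem abs_log_le_rpow_add {w : ℝ} (hw : 0 < w) :
    |Real.log w| ≤ 2 * w ^ (-(1 / 2) : ℝ) + w := by
  have hp : 0 < w ^ (-(1 / 2) : ℝ) := Real.rpow_pos_of_pos hw _
  rw [abs_le]
  constructor
  · have h := Real.log_le_rpow_div (inv_pos.2 hw).le (ε := 1 / 2) (by norm_num)
    rw [Real.log_inv, Real.inv_rpow hw.le, ← Real.rpow_neg hw.le] at h
    linarith
  · linarith [Real.log_le_sub_one_of_pos hw]

theorem integrableOn_abs_log_mul_exp_neg : MeasureTheory.IntegrableOn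
    (fun w : ℝ => |Real.log w| * Real.exp (-w)) (Set.Ioi 0) := by
  have h1 : MeasureTheory.IntegrableOn (fun w : ℝ => Real.exp (-w) * w ^ ((1 / 2 : ℝ) - 1))
    (Set.Ioi 0) := Real.GammaIntegral_convergent (by norm_num)
  have h2 := integrableOn_pow_mul_exp_neg 1 one_pos
  refine MeasureTheory.Integrable.mono' ((h1.const_mul 2).add h2) ?_
    ((MeasureTheory.ae_restrict_iff' measurableSet_Ioi).2 (Eventually.of_forall fun w hw => ?_))
  · exact ((Real.measurable_log.norm).mul (by fun_prop)).aestronglyMeasurable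
  · rw [Real.norm_of_nonneg (by positivity)]
    have := mul_le_mul_of_nonneg_right (abs_log_le_rpow_add hw) (Real.exp_pos (-w)).le
    refine this.trans_eq ?_
    simp only [Pi.add_apply, one_mul, pow_one]
    rw [show (1 / 2 : ℝ) - 1 = -(1 / 2) by norm_num]
    ring

theorem integral_log_mul_exp_neg :
    ∫ w in Set.Ioi (0 : ℝ), Real.log w * Real.exp (-w) = deriv Real.Gamma 1 := by
  have h1 := Complex.hasDerivAt_GammaIntegral (s := 1) (by norm_num)
  have h2 : HasDerivAt Complex.Gamma _ 1 := h1.congr_of_eventuallyEq (by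
    filter_upwards [(isOpen_lt continuous_const Complex.continuous_re).mem_nhds
      (show (0 : ℝ) < (1 : ℂ).re by norm_num)] with s hs using Complex.Gamma_eq_integral hs)
  have h3 := h2.unique Complex.hasDerivAt_Gamma_one
  rw [← neg_eq_iff_eq_neg.2 Real.eulerMascheroniConstant_eq_neg_deriv]
  have h4 : ((∫ w in Set.Ioi (0 : ℝ), Real.log w * Real.exp (-w) : ℝ) : ℂ) =
      -(Real.eulerMascheroniConstant : ℂ) := by
    rw [← h3, ← integral_complex_ofReal]
    congr 1
    ext w
    simp
  exact_mod_cast h4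

/-- As u/(1+u^2) is not integrable, the behaviour for x → 0 cannot be read off directly. Integration
by parts against ½ log(1+u^2) prepares the extraction of the logarithm. -/
theorem laplaceAux_one_eq {x : ℝ} (hx : 0 < x) :
    laplaceAux 1 x = ∫ u in Set.Ioi (0 : ℝ),
      x * (1 / 2 * Real.log (1 + u ^ 2) * Real.exp (-(x * u))) := by
  have hlog : ∀ u : ℝ, 0 ≤ Real.log (1 + u ^ 2) ∧ Real.log (1 + u ^ 2) ≤ u ^ 2 := fun u =>
    ⟨Real.log_nonneg (by nlinarith [sq_nonneg u]), by
      linarith [Real.log_le_sub_one_of_pos (show 0 < 1 + u ^ 2 by positivity)]⟩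
  have hcl : Continuous fun u : ℝ => Real.log (1 + u ^ 2) :=
    Continuous.log (by fun_prop) fun u => by positivity
  have hintg : MeasureTheory.IntegrableOn
      (fun u : ℝ => x * (1 / 2 * Real.log (1 + u ^ 2) * Real.exp (-(x * u)))) (Set.Ioi 0) := by
    refine MeasureTheory.Integrable.const_mul ?_ x
    refine MeasureTheory.Integrable.mono' (integrableOn_pow_mul_exp_neg 2 hx)
      (by fun_prop : Continuous _).aestronglyMeasurable (Eventually.of_forall fun u => ?_)
    obtain ⟨a, b⟩ := hlog u
    rw [Real.norm_of_nonneg (by positivity)]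
    refine mul_le_mul_of_nonneg_right ?_ (Real.exp_pos _).le
    linarith
  have hderiv : ∀ u ∈ Set.Ioi (0 : ℝ), HasDerivAt
      (fun u : ℝ => 1 / 2 * Real.log (1 + u ^ 2) * Real.exp (-(x * u)))
      (u ^ 1 * Real.exp (-(x * u)) / (1 + u ^ 2) -
        x * (1 / 2 * Real.log (1 + u ^ 2) * Real.exp (-(x * u)))) u := by
    intro u _
    have hne : (1 : ℝ) + u ^ 2 ≠ 0 := by positivity
    have d1 := (((hasDerivAt_pow 2 u).const_add 1).log hne).const_mul (1 / 2 : ℝ)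
    have d2 : HasDerivAt (fun u : ℝ => Real.exp (-(x * u))) (Real.exp (-(x * u)) * (-(x * 1))) u :=
      ((hasDerivAt_id u).const_mul x).neg.exp
    refine (d1.mul d2).congr_deriv ?_
    field_simp
    push_cast
    ring
  have hlim : Tendsto (fun u : ℝ => 1 / 2 * Real.log (1 + u ^ 2) * Real.exp (-(x * u))) atTop
      (𝓝 0) := by
    have hz : Tendsto (fun u : ℝ => u ^ 2 * Real.exp (-(x * u))) atTop (𝓝 0) := by
      have := (isLittleO_exp_neg_mul_rpow_atTop hx (-2)).tendsto_div_nhds_zero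
      refine this.congr' ?_
      filter_upwards [eventually_gt_atTop 0] with u hu
      rw [Real.rpow_neg hu.le, div_inv_eq_mul, mul_comm, neg_mul]
      norm_cast
    refine squeeze_zero (fun u => ?_) (fun u => ?_) hz
    · have := (hlog u).1
      positivity
    · refine mul_le_mul_of_nonneg_right ?_ (Real.exp_pos _).le
      linarith [(hlog u).1, (hlog u).2]
  have h := MeasureTheory.integral_Ioi_of_hasDerivAt_of_tendsto
    (by fun_prop : Continuous fun u : ℝ =>
      1 / 2 * Real.log (1 + u ^ 2) * Real.exp (-(x * u))).continuousWithinAt hderiv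
    ((integrableOn_laplaceAux 1 hx).sub hintg) hlim
  rw [MeasureTheory.integral_sub (integrableOn_laplaceAux 1 hx) hintg] at h
  simp at h
  simp only [laplaceAux]
  simpa using sub_eq_zero.1 h

/-- The substitution w = xu turns ½ log(1+u^2) into ½ log(x^2+w^2) - log x, and e^{-w} has total
mass 1. -/
theorem laplaceAux_one_add_log {x : ℝ} (hx : 0 < x) :
    laplaceAux 1 x + Real.log x =
      ∫ w in Set.Ioi (0 : ℝ), 1 / 2 * Real.log (x ^ 2 + w ^ 2) * Real.exp (-w) := by
  have hsub := MeasureTheory.integral_comp_mul_left_Ioi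
    (fun w : ℝ => 1 / 2 * Real.log (1 + (w / x) ^ 2) * Real.exp (-w)) 0 hx
  have hx0 := hx.ne'
  simp only [mul_div_cancel_left₀ _ hx0, mul_zero, smul_eq_mul] at hsub
  have hexp : MeasureTheory.IntegrableOn (fun w : ℝ => Real.log x * Real.exp (-w)) (Set.Ioi 0) := by
    have := (integrableOn_pow_mul_exp_neg 0 one_pos).const_mul (Real.log x)
    simpa [MeasureTheory.IntegrableOn] using this
  have hexp1 : ∫ w in Set.Ioi (0 : ℝ), Real.log x * Real.exp (-w) = Real.log x := by
    have := integral_pow_mul_exp_neg 0 one_pos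
    simp only [pow_zero, one_mul, Nat.factorial_zero, Nat.cast_one, one_pow, div_one] at this
    rw [MeasureTheory.integral_const_mul, this, mul_one]
  have hcl : Continuous fun w : ℝ => Real.log (1 + (w / x) ^ 2) :=
    Continuous.log (by fun_prop) fun u => by positivity
  have hintg : MeasureTheory.IntegrableOn
      (fun w : ℝ => 1 / 2 * Real.log (1 + (w / x) ^ 2) * Real.exp (-w)) (Set.Ioi 0) := by
    refine MeasureTheory.Integrable.mono'
      ((integrableOn_pow_mul_exp_neg 2 one_pos).const_mul (x ^ 2)⁻¹)
      (by fun_prop : Continuous _).aestronglyMeasurable (Eventually.of_forall fun u => ?_)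
    have a : 0 ≤ Real.log (1 + (u / x) ^ 2) := Real.log_nonneg (by nlinarith [sq_nonneg (u / x)])
    have b := Real.log_le_sub_one_of_pos (show 0 < 1 + (u / x) ^ 2 by positivity)
    rw [Real.norm_of_nonneg (by positivity), ← mul_assoc, one_mul]
    refine mul_le_mul_of_nonneg_right ?_ (Real.exp_pos _).le
    rw [← div_eq_inv_mul, ← div_pow]
    linarith
  rw [laplaceAux_one_eq hx, MeasureTheory.integral_const_mul, hsub, mul_inv_cancel_left₀ hx0]
  conv_lhs => rw [← hexp1]
  rw [← MeasureTheory.integral_add hintg hexp]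
  congr 1
  ext w
  have h1 : x ^ 2 + w ^ 2 = x ^ 2 * (1 + (w / x) ^ 2) := by field_simp
  rw [h1, Real.log_mul (by positivity) (by positivity), Real.log_pow]
  push_cast
  ring

/-- The integrand tends to log w · e^{-w}, whose integral is Γ'(1). For 0 < x < 1 one has 2 log w ≤
log(x^2+w^2) ≤ w^2, which supplies the dominating function. -/
theorem tendsto_laplaceAux_one_add_log :
    Tendsto (fun x => laplaceAux 1 x + Real.log x) (𝓝[>] 0) (𝓝 (deriv Real.Gamma 1)) := by
  rw [← integral_log_mul_exp_neg]
  refine Tendsto.congr' (f₁ := fun x : ℝ =>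
    ∫ w in Set.Ioi (0 : ℝ), 1 / 2 * Real.log (x ^ 2 + w ^ 2) * Real.exp (-w)) ?_ ?_
  · filter_upwards [self_mem_nhdsWithin] with x hx using (laplaceAux_one_add_log hx).symm
  refine MeasureTheory.tendsto_integral_filter_of_dominated_convergence
    (fun w => |Real.log w| * Real.exp (-w) + w ^ 2 * Real.exp (-(1 * w))) ?_ ?_
    (MeasureTheory.Integrable.add integrableOn_abs_log_mul_exp_neg
      (integrableOn_pow_mul_exp_neg 2 one_pos)) ?_
  · refine Eventually.of_forall fun x => ?_
    refine Measurable.aestronglyMeasurable ?_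
    exact ((Real.measurable_log.comp (by fun_prop)).const_mul _).mul (by fun_prop)
  · filter_upwards [Ioo_mem_nhdsGT (zero_lt_one' ℝ)] with x hx
    refine (MeasureTheory.ae_restrict_iff' measurableSet_Ioi).2 (Eventually.of_forall fun w hw => ?_)
    have hw' : 0 < w := hw
    have l1 : 2 * Real.log w ≤ Real.log (x ^ 2 + w ^ 2) := by
      have := Real.log_le_log (show 0 < w ^ 2 by positivity)
        (show w ^ 2 ≤ x ^ 2 + w ^ 2 by nlinarith [sq_nonneg x])
      rwa [Real.log_pow, Nat.cast_ofNat] at this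
    have l2 : Real.log (x ^ 2 + w ^ 2) ≤ w ^ 2 := by
      have := Real.log_le_sub_one_of_pos (show 0 < x ^ 2 + w ^ 2 by positivity)
      nlinarith [hx.1, hx.2]
    rw [norm_mul, Real.norm_of_nonneg (Real.exp_pos _).le, one_mul, ← add_mul]
    refine mul_le_mul_of_nonneg_right ?_ (Real.exp_pos _).le
    rw [Real.norm_eq_abs, abs_le]
    constructor
    · nlinarith [neg_abs_le (Real.log w), sq_nonneg w]
    · nlinarith [abs_nonneg (Real.log w), sq_nonneg w]
  · refine (MeasureTheory.ae_restrict_iff' measurableSet_Ioi).2 (Eventually.of_forall fun w hw => ?_)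
    have hw' : 0 < w := hw
    have hc : ContinuousAt
        (fun x : ℝ => 1 / 2 * Real.log (x ^ 2 + w ^ 2) * Real.exp (-w)) 0 := by
      refine ((ContinuousAt.log (by fun_prop) (by positivity)).const_mul _).mul_const _
    have := hc.tendsto.mono_left (nhdsWithin_le_nhds (s := Set.Ioi 0))
    have e : 1 / 2 * Real.log (0 ^ 2 + w ^ 2) = Real.log w := by
      rw [zero_pow two_ne_zero, zero_add, Real.log_pow]
      push_cast
      ring
    rwa [e] at this

theorem eq_of_hasDerivAt_zero_of_tendsto {f : ℝ → ℝ} {c : ℝ}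
    (hf : ∀ x, 0 < x → HasDerivAt f 0 x) (hc : Tendsto f (𝓝[>] 0) (𝓝 c)) {x : ℝ} (hx : 0 < x) :
    f x = c := by
  have hconst : ∀ y ∈ Set.Ioi (0 : ℝ), f y = f x := fun y hy =>
    isOpen_Ioi.is_const_of_deriv_eq_zero isPreconnected_Ioi
      (fun z hz => (hf z hz).differentiableAt.differentiableWithinAt)
      (fun z hz => (hf z hz).deriv) hy hx
  refine tendsto_nhds_unique (tendsto_const_nhds.congr' ?_) hc
  filter_upwards [self_mem_nhdsWithin] with y hy using (hconst y hy).symm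

/-! ### Sine and cosine integrals -/

/-- The continuous extension of `(1 - cos y) / y`. -/
noncomputable def cosc (y : ℝ) : ℝ := Real.sin (y / 2) * Real.sinc (y / 2)

theorem continuous_cosc : Continuous cosc := by
  unfold cosc
  have := Real.continuous_sinc
  fun_prop

theorem cosc_mul_self (y : ℝ) : cosc y * y = 1 - Real.cos y := by
  have h : Real.cos y = 1 - 2 * Real.sin (y / 2) ^ 2 := by
    rw [Real.sin_sq, ← mul_div_cancel₀ y two_ne_zero, mul_div_cancel_left₀ _ (two_ne_zero' ℝ),
      Real.cos_two_mul]
    ring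
  rcases eq_or_ne y 0 with rfl | hy
  · simp
  · rw [cosc, Real.sinc_of_ne_zero (by positivity), h]
    field_simp
    ring

theorem sinc_mul_self (y : ℝ) : Real.sinc y * y = Real.sin y := by
  rcases eq_or_ne y 0 with rfl | hy
  · simp
  · rw [Real.sinc_of_ne_zero hy, div_mul_cancel₀ _ hy]

theorem tendsto_log_mul_self_nhdsGT : Tendsto (fun x => Real.log x * x) (𝓝[>] 0) (𝓝 0) := by
  simpa only [Real.rpow_one] using tendsto_log_mul_rpow_nhdsGT_zero zero_lt_one

theorem tendsto_log_mul_sin : Tendsto (fun x => Real.log x * Real.sin x) (𝓝[>] 0) (𝓝 0) := by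
  have h := tendsto_log_mul_self_nhdsGT.mul
    ((Real.continuous_sinc.tendsto 0).mono_left (nhdsWithin_le_nhds (s := Set.Ioi 0)))
  rw [zero_mul] at h
  refine h.congr fun x => ?_
  rw [← sinc_mul_self]; ring

theorem tendsto_log_mul_one_sub_cos :
    Tendsto (fun x => Real.log x * (1 - Real.cos x)) (𝓝[>] 0) (𝓝 0) := by
  have h := tendsto_log_mul_self_nhdsGT.mul
    ((continuous_cosc.tendsto 0).mono_left (nhdsWithin_le_nhds (s := Set.Ioi 0)))
  rw [zero_mul] at h
  refine h.congr fun x => ?_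
  rw [← cosc_mul_self]; ring

/-- The difference of the two sides has derivative zero by the recursion, so it is determined by its
limit at 0+. There the logarithmic singularity of `laplaceAux 1` is killed by sin x. -/
theorem integral_sinc_eq {x : ℝ} (hx : 0 < x) :
    ∫ y in (0 : ℝ)..x, Real.sinc y =
      Real.pi / 2 - laplaceAux 0 x * Real.cos x - laplaceAux 1 x * Real.sin x := by
  have hd : ∀ x, 0 < x → HasDerivAt (fun x => (∫ y in (0 : ℝ)..x, Real.sinc y) +
      laplaceAux 0 x * Real.cos x + laplaceAux 1 x * Real.sin x) 0 x := by
    intro x hx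
    have d1 := (Real.continuous_sinc.integral_hasStrictDerivAt 0 x).hasDerivAt
    refine ((d1.add ((hasDerivAt_laplaceAux 0 hx).mul (Real.hasDerivAt_cos x))).add
      ((hasDerivAt_laplaceAux 1 hx).mul (Real.hasDerivAt_sin x))).congr_deriv ?_
    rw [show 1 + 1 = 0 + 2 from rfl, laplaceAux_add_two 0 hx, Real.sinc_of_ne_zero hx.ne']
    simp only [Nat.factorial_zero, zero_add, pow_one, Nat.cast_one]
    ring
  have hlim : Tendsto (fun x => (∫ y in (0 : ℝ)..x, Real.sinc y) +
      laplaceAux 0 x * Real.cos x + laplaceAux 1 x * Real.sin x) (𝓝[>] 0) (𝓝 (Real.pi / 2)) := by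
    have l1 : Tendsto (fun x => ∫ y in (0 : ℝ)..x, Real.sinc y) (𝓝[>] 0) (𝓝 0) := by
      have := (Real.continuous_sinc.integral_hasStrictDerivAt 0 0).hasDerivAt.continuousAt.tendsto
      rw [intervalIntegral.integral_same] at this
      exact this.mono_left nhdsWithin_le_nhds
    have lc : Tendsto Real.cos (𝓝[>] 0) (𝓝 1) := by
      simpa using (Real.continuous_cos.tendsto 0).mono_left (nhdsWithin_le_nhds (s := Set.Ioi 0))
    have ls : Tendsto Real.sin (𝓝[>] 0) (𝓝 0) := by
      simpa using (Real.continuous_sin.tendsto 0).mono_left (nhdsWithin_le_nhds (s := Set.Ioi 0))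
    have l2 := (tendsto_laplaceAux_one_add_log.mul ls).sub tendsto_log_mul_sin
    have := (l1.add (tendsto_laplaceAux_zero.mul lc)).add l2
    simp only [mul_zero, sub_zero, add_zero, zero_add, mul_one] at this
    refine this.congr fun x => ?_
    ring
  linarith [eq_of_hasDerivAt_zero_of_tendsto hd hlim hx]

theorem integral_cosc_eq {x : ℝ} (hx : 0 < x) :
    ∫ y in (0 : ℝ)..x, cosc y =
      -deriv Real.Gamma 1 + Real.log x - laplaceAux 0 x * Real.sin x +
        laplaceAux 1 x * Real.cos x := by
  have hd : ∀ x, 0 < x → HasDerivAt (fun x => (∫ y in (0 : ℝ)..x, cosc y) - Real.log x +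
      laplaceAux 0 x * Real.sin x - laplaceAux 1 x * Real.cos x) 0 x := by
    intro x hx
    have d1 := (continuous_cosc.integral_hasStrictDerivAt 0 x).hasDerivAt
    refine (((d1.sub (Real.hasDerivAt_log hx.ne')).add
      ((hasDerivAt_laplaceAux 0 hx).mul (Real.hasDerivAt_sin x))).sub
      ((hasDerivAt_laplaceAux 1 hx).mul (Real.hasDerivAt_cos x))).congr_deriv ?_
    rw [show 1 + 1 = 0 + 2 from rfl, laplaceAux_add_two 0 hx,
      eq_div_of_mul_eq hx.ne' (cosc_mul_self x)]
    simp only [Nat.factorial_zero, zero_add, pow_one, Nat.cast_one]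
    ring
  have hlim : Tendsto (fun x => (∫ y in (0 : ℝ)..x, cosc y) - Real.log x +
      laplaceAux 0 x * Real.sin x - laplaceAux 1 x * Real.cos x) (𝓝[>] 0)
      (𝓝 (-deriv Real.Gamma 1)) := by
    have l1 : Tendsto (fun x => ∫ y in (0 : ℝ)..x, cosc y) (𝓝[>] 0) (𝓝 0) := by
      have := (continuous_cosc.integral_hasStrictDerivAt 0 0).hasDerivAt.continuousAt.tendsto
      rw [intervalIntegral.integral_same] at this
      exact this.mono_left nhdsWithin_le_nhds
    have lc : Tendsto Real.cos (𝓝[>] 0) (𝓝 1) := by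
      simpa using (Real.continuous_cos.tendsto 0).mono_left (nhdsWithin_le_nhds (s := Set.Ioi 0))
    have ls : Tendsto Real.sin (𝓝[>] 0) (𝓝 0) := by
      simpa using (Real.continuous_sin.tendsto 0).mono_left (nhdsWithin_le_nhds (s := Set.Ioi 0))
    -- The singularities cancel by A cos x + log x = (A + log x) cos x + (log x)(1 - cos x), where A
    -- denotes `laplaceAux 1 x`.
    have l2 := (tendsto_laplaceAux_one_add_log.mul lc).add tendsto_log_mul_one_sub_cos
    have := (l1.add (tendsto_laplaceAux_zero.mul ls)).sub l2
    simp only [mul_zero, add_zero, mul_one, zero_sub] at this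
    refine this.congr fun x => ?_
    ring
  linarith [eq_of_hasDerivAt_zero_of_tendsto hd hlim hx]

/-- The kernel `(cos l - cos (l - l x)) / x`, extended continuously to `x = 0`. -/
noncomputable def cosDiffQuot (l x : ℝ) : ℝ :=
  l * (Real.cos l * cosc (l * x) - Real.sin l * Real.sinc (l * x))

theorem continuous_cosDiffQuot (l : ℝ) : Continuous (cosDiffQuot l) := by
  unfold cosDiffQuot
  have := Real.continuous_sinc
  have := continuous_cosc
  fun_prop

theorem cosDiffQuot_mul_self (l x : ℝ) :
    cosDiffQuot l x * x = Real.cos l - Real.cos (l * (1 - x)) := by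
  have h1 := cosc_mul_self (l * x)
  have h2 := sinc_mul_self (l * x)
  have h3 : Real.cos (l * (1 - x)) = Real.cos l * Real.cos (l * x) + Real.sin l * Real.sin (l * x) := by
    rw [← Real.cos_sub]; congr 1; ring
  rw [h3, cosDiffQuot]
  linear_combination Real.cos l * h1 - Real.sin l * h2

/-- Partial fractions 2/(1-r^2) = 1/(1-r) + 1/(1+r); the numerators agree since the cosine is even.
-/
theorem cosDiffQuot_add {l r : ℝ} (h1 : 1 - r ≠ 0) (h2 : 1 + r ≠ 0) :
    cosDiffQuot l (1 - r) + cosDiffQuot l (1 + r) =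
      2 * (Real.cos l - Real.cos (l * r)) / (1 - r ^ 2) := by
  have e1 := cosDiffQuot_mul_self l (1 - r)
  have e2 := cosDiffQuot_mul_self l (1 + r)
  rw [sub_sub_cancel] at e1
  rw [show l * (1 - (1 + r)) = -(l * r) by ring, Real.cos_neg] at e2
  rw [show 1 - r ^ 2 = (1 - r) * (1 + r) by ring, eq_div_iff (mul_ne_zero h1 h2)]
  linear_combination (1 + r) * e1 + (1 - r) * e2

/-- The two summands cover [0,1] and [1,2] and glue to one integral over [0,2], hence to the sine
and cosine integrals at 2l. The addition theorems then reduce the angles l and 2l to l. -/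
theorem integral_cosDiffQuot_add {l : ℝ} (hl : 0 < l) :
    ∫ r in (0 : ℝ)..1, (cosDiffQuot l (1 - r) + cosDiffQuot l (1 + r)) =
      -(Real.sin l * (Real.pi / 2 + laplaceAux 0 (2 * l)) +
        Real.cos l * (-Real.log (2 * l) + deriv Real.Gamma 1 - laplaceAux 1 (2 * l))) := by
  have hc := continuous_cosDiffQuot l
  rw [intervalIntegral.integral_add ((by fun_prop : Continuous _).intervalIntegrable _ _)
    ((by fun_prop : Continuous _).intervalIntegrable _ _),
    intervalIntegral.integral_comp_sub_left (cosDiffQuot l),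
    intervalIntegral.integral_comp_add_left (cosDiffQuot l)]
  norm_num
  rw [intervalIntegral.integral_add_adjacent_intervals (hc.intervalIntegrable _ _)
    (hc.intervalIntegrable _ _)]
  unfold cosDiffQuot
  have hl0 := hl.ne'
  rw [intervalIntegral.integral_const_mul,
    intervalIntegral.mul_integral_comp_mul_left
      (f := fun y => Real.cos l * cosc y - Real.sin l * Real.sinc y), mul_zero,
    intervalIntegral.integral_sub ((continuous_cosc.const_mul _).intervalIntegrable _ _)
      ((Real.continuous_sinc.const_mul _).intervalIntegrable _ _),
    intervalIntegral.integral_const_mul, intervalIntegral.integral_const_mul, mul_comm l 2,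
    integral_cosc_eq (by positivity), integral_sinc_eq (by positivity), Real.cos_two_mul,
    Real.sin_two_mul]
  linear_combination (2 * laplaceAux 1 (2 * l) * Real.cos l)
    * Real.sin_sq_add_cos_sq l

/-! ### The operator # as an integral -/

/-- Holomorphy on the disc ensures convergence on the whole interval |x| < R, which real analyticity
alone would not. Taking real parts avoids showing that the Taylor coefficients are real. -/
theorem exists_hasSum_even_powers {G : ℂ → ℂ} {R : ℝ}
    (hG : DifferentiableOn ℂ G (Metric.ball 0 R)) (heven : ∀ w, G (-w) = G w) :
    ∃ c : ℕ → ℝ, ∀ x : ℝ, |x| < R → HasSum (fun j : ℕ => c j * x ^ (2 * j)) (G x).re := by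
  refine ⟨fun j => (((2 * j).factorial : ℂ)⁻¹ * iteratedDeriv (2 * j) G 0).re, fun x hx => ?_⟩
  have hxb : (x : ℂ) ∈ Metric.ball (0 : ℂ) R := by simpa using hx
  have h := Complex.hasSum_taylorSeries_on_ball hG hxb
  have hodd : ∀ n : ℕ, n ∉ Set.range (fun j : ℕ => 2 * j) →
      ((n.factorial : ℂ)⁻¹ • ((x : ℂ) - 0) ^ n • iteratedDeriv n G 0) = 0 := by
    intro n hn
    have hn' : Odd n := by
      rw [← Nat.not_even_iff_odd]
      rintro ⟨j, rfl⟩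
      exact hn ⟨j, by ring⟩
    have h1 := iteratedDeriv_comp_neg n G 0
    rw [show (fun w => G (-w)) = G from funext heven, hn'.neg_one_pow, neg_zero, neg_smul,
      one_smul] at h1
    rw [self_eq_neg.1 h1, smul_zero, smul_zero]
  have hinj : Function.Injective fun j : ℕ => 2 * j := fun a b hab => by
    simpa using hab
  have h2 := Complex.hasSum_re ((hinj.hasSum_iff hodd).2 h)
  refine h2.congr_fun fun j => ?_
  simp only [Function.comp, sub_zero, smul_eq_mul]
  rw [mul_left_comm, ← Complex.ofReal_pow, Complex.re_ofReal_mul, mul_comm]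

/-- The right-hand side is 2∫_0^1 ∑_{i≤k} r^(2i) dr, which is what makes # an integral operator. -/
theorem two_mul_harmonic_sub (k : ℕ) :
    2 * (harmonic (2 * k + 1) : ℝ) - (harmonic k : ℝ) =
      2 * ∑ i ∈ Finset.range (k + 1), 1 / (2 * (i : ℝ) + 1) := by
  induction k with
  | zero => simp [harmonic]
  | succ k ih =>
    rw [Finset.sum_range_succ, mul_add (2 : ℝ) (∑ _ ∈ _, _), ← ih, show 2 * (k + 1) + 1 = 2 * k + 1 + 1 + 1 by ring,
      harmonic_succ, harmonic_succ (2 * k + 1), harmonic_succ k]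
    push_cast
    field_simp
    ring

theorem summable_mul_succ_mul_pow {c : ℕ → ℝ} {R : ℝ}
    (hc : ∀ x : ℝ, |x| < R → Summable fun j : ℕ => c j * x ^ (2 * j)) {t : ℝ} (ht : |t| < R) :
    Summable fun k : ℕ => 2 * |c (k + 1)| * |t| ^ (2 * k) * (k + 1) := by
  obtain ⟨ρ, h1, h2⟩ := exists_between ht
  have hρ : 0 < ρ := (abs_nonneg t).trans_lt h1
  have hb := (hc ρ (by rwa [abs_of_pos hρ])).tendsto_atTop_zero.norm.bddAbove_range
  obtain ⟨M, hM⟩ := hb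
  have hM' : ∀ j, |c j| * ρ ^ (2 * j) ≤ M := fun j => by
    have := hM ⟨j, rfl⟩
    simpa [abs_mul, abs_of_pos hρ] using this
  set q := (|t| / ρ) ^ 2 with hq
  have hq0 : 0 ≤ q := by positivity
  have hq1 : q < 1 := by
    rw [hq, sq_lt_one_iff₀ (by positivity), div_lt_one hρ]
    exact h1
  have hg : Summable fun k : ℕ => 2 * M / ρ ^ 2 * ((k : ℝ) ^ 1 * q ^ k + q ^ k) := by
    refine Summable.mul_left _ (Summable.add ?_ (summable_geometric_of_lt_one hq0 hq1))
    exact summable_pow_mul_geometric_of_norm_lt_one 1 (by rwa [Real.norm_of_nonneg hq0])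
  refine Summable.of_nonneg_of_le (fun k => by positivity) (fun k => ?_) hg
  have h := hM' (k + 1)
  have hle : |c (k + 1)| ≤ M / ρ ^ (2 * (k + 1)) := by rwa [le_div_iff₀ (by positivity)]
  calc 2 * |c (k + 1)| * |t| ^ (2 * k) * (k + 1)
      ≤ 2 * (M / ρ ^ (2 * (k + 1))) * |t| ^ (2 * k) * (k + 1) := by gcongr
    _ = _ := by
      rw [hq, ← pow_mul, div_pow]
      field_simp
      ring

/-- Expand h(t) - h(tr), divide by 1 - r^2 as a finite geometric sum and integrate termwise. The
coefficient `c 0` drops out of the difference, in accordance with (t^{-2})^# = 0. -/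
theorem hasSum_sharp {c : ℕ → ℝ} {h : ℝ → ℝ} {R : ℝ}
    (hc : ∀ x : ℝ, |x| < R → HasSum (fun j : ℕ => c j * x ^ (2 * j)) (h x)) {t : ℝ} (ht0 : t ≠ 0)
    (ht : |t| < R) :
    HasSum (fun k : ℕ =>
      c (k + 1) * (2 * (harmonic (2 * k + 1) : ℝ) - (harmonic k : ℝ)) * t ^ (2 * k))
      (∫ r in (0 : ℝ)..1, 2 * (h t - h (t * r)) / (t ^ 2 * (1 - r ^ 2))) := by
  have hs := summable_mul_succ_mul_pow (fun x hx => (hc x hx).summable) ht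
  have key := intervalIntegral.hasSum_integral_of_dominated_convergence
    (μ := MeasureTheory.volume) (a := 0) (b := 1)
    (F := fun (k : ℕ) (r : ℝ) => 2 * c (k + 1) * t ^ (2 * k) *
      ∑ i ∈ Finset.range (k + 1), r ^ (2 * i))
    (f := fun r => 2 * (h t - h (t * r)) / (t ^ 2 * (1 - r ^ 2)))
    (fun k _ => 2 * |c (k + 1)| * |t| ^ (2 * k) * (k + 1))
    (fun k => (by fun_prop : Continuous _).aestronglyMeasurable)
    (fun k => Eventually.of_forall fun r hr => ?_) (Eventually.of_forall fun r _ => hs)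
    intervalIntegrable_const ?_
  · refine key.congr_fun fun k => ?_
    rw [intervalIntegral.integral_const_mul, intervalIntegral.integral_finsetSum fun i _ =>
      (continuous_pow _).intervalIntegrable _ _, two_mul_harmonic_sub]
    simp only [integral_pow, one_pow]
    have : ∀ i : ℕ, ((1 : ℝ) - 0 ^ (2 * i + 1)) / ((2 * i : ℕ) + 1) = 1 / (2 * (i : ℝ) + 1) := by
      intro i
      rw [zero_pow (Nat.succ_ne_zero _), sub_zero]
      push_cast
      rfl
    simp only [this]
    ring
  · rw [Set.uIoc_of_le zero_le_one] at hr
    rw [norm_mul, norm_mul, norm_mul, norm_pow]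
    simp only [Real.norm_eq_abs, abs_two]
    refine mul_le_mul_of_nonneg_left ?_ (by positivity)
    refine (Finset.abs_sum_le_sum_abs _ _).trans ?_
    have : ∀ i ∈ Finset.range (k + 1), |r ^ (2 * i)| ≤ 1 := fun i _ => by
      rw [abs_of_nonneg (pow_nonneg hr.1.le _)]
      exact pow_le_one₀ hr.1.le hr.2
    simpa using Finset.sum_le_sum this
  · have hne : ∀ᵐ r : ℝ ∂MeasureTheory.volume, r ≠ 1 := by
      simp [MeasureTheory.ae_iff]
    filter_upwards [hne] with r hr1 hr
    rw [Set.uIoc_of_le zero_le_one] at hr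
    have hr2 : (1 : ℝ) - r ^ 2 ≠ 0 := by
      have : r < 1 := lt_of_le_of_ne hr.2 hr1
      nlinarith [hr.1]
    have htr : |t * r| < R := by
      rw [abs_mul, abs_of_pos hr.1]
      exact (mul_le_of_le_one_right (abs_nonneg t) hr.2).trans_lt ht
    have hd := ((hasSum_nat_add_iff' 1).2 ((hc t ht).sub (hc _ htr))).mul_left
      (2 / (t ^ 2 * (1 - r ^ 2)))
    simp only [Finset.range_one, Finset.sum_singleton, mul_zero, pow_zero, sub_self, sub_zero] at hd
    rw [← mul_div_right_comm] at hd
    refine hd.congr_fun fun k => ?_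
    have hgeom : (∑ i ∈ Finset.range (k + 1), r ^ (2 * i)) * (1 - r ^ 2) = 1 - r ^ (2 * (k + 1)) := by
      simp only [pow_mul]
      rw [geom_sum_mul_neg]
    have hfac : c (k + 1) * t ^ (2 * (k + 1)) - c (k + 1) * (t * r) ^ (2 * (k + 1)) =
        c (k + 1) * t ^ (2 * k) * t ^ 2 *
          ((∑ i ∈ Finset.range (k + 1), r ^ (2 * i)) * (1 - r ^ 2)) := by
      rw [hgeom]
      ring
    rw [hfac]
    field_simp

/-- The complex continuation of `x ^ 2 * cos (L x / 2) / (x sin (x / 2))`. -/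
noncomputable def sharpNumerator (L : ℕ) (w : ℂ) : ℂ :=
  2 * Complex.cos (L * w / 2) / dslope Complex.sin 0 (w / 2)

theorem dslope_sin_neg (w : ℂ) : dslope Complex.sin 0 (-w) = dslope Complex.sin 0 w := by
  rcases eq_or_ne w 0 with rfl | hw
  · rw [neg_zero]
  · rw [dslope_of_ne _ hw, dslope_of_ne _ (neg_ne_zero.2 hw), slope_def_field, slope_def_field]
    simp [neg_div_neg_eq]

theorem dslope_sin_ne_zero {w : ℂ} (hw : ‖w‖ < Real.pi) : dslope Complex.sin 0 w ≠ 0 := by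
  rcases eq_or_ne w 0 with rfl | hw0
  · rw [dslope_same, Complex.deriv_sin, Complex.cos_zero]
    exact one_ne_zero
  · rw [dslope_of_ne _ hw0, slope_def_field, Complex.sin_zero, sub_zero, sub_zero]
    refine div_ne_zero (fun h => ?_) hw0
    obtain ⟨k, hk⟩ := Complex.sin_eq_zero_iff.1 h
    rw [hk, norm_mul, Complex.norm_intCast, Complex.norm_real,
      Real.norm_of_nonneg Real.pi_pos.le] at hw
    have h1 : |(k : ℝ)| < 1 := by
      by_contra hcon
      exact absurd hw (not_lt.2 (le_mul_of_one_le_left Real.pi_pos.le (not_lt.1 hcon)))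
    have h2 : |k| < 1 := by exact_mod_cast h1
    rw [Int.abs_lt_one_iff] at h2
    rw [h2] at hk
    exact hw0 (by simpa using hk)

theorem differentiable_dslope_sin : Differentiable ℂ (dslope Complex.sin 0) := by
  rw [← differentiableOn_univ, Complex.differentiableOn_dslope univ_mem]
  exact Complex.differentiable_sin.differentiableOn

theorem differentiableOn_sharpNumerator (L : ℕ) :
    DifferentiableOn ℂ (sharpNumerator L) (Metric.ball 0 (2 * Real.pi)) := by
  intro w hw
  unfold sharpNumerator
  refine DifferentiableAt.differentiableWithinAt (DifferentiableAt.div ?_ ?_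
    (dslope_sin_ne_zero ?_))
  · fun_prop
  · exact (differentiable_dslope_sin _).comp w (by fun_prop)
  · rw [mem_ball_zero_iff] at hw
    rw [norm_div, Complex.norm_ofNat]
    linarith

theorem sharpNumerator_neg (L : ℕ) (w : ℂ) : sharpNumerator L (-w) = sharpNumerator L w := by
  rw [sharpNumerator, sharpNumerator, neg_div, dslope_sin_neg, mul_neg, neg_div, Complex.cos_neg]

theorem sharpNumerator_ofReal_re (L : ℕ) {x : ℝ} (hx : x ≠ 0) :
    (sharpNumerator L x).re = x * Real.cos (L * x / 2) / Real.sin (x / 2) := by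
  have hx2 : (x : ℂ) / 2 ≠ 0 := div_ne_zero (Complex.ofReal_ne_zero.2 hx) two_ne_zero
  have : sharpNumerator L x = ((x * Real.cos (L * x / 2) / Real.sin (x / 2) : ℝ) : ℂ) := by
    rw [sharpNumerator, dslope_of_ne _ hx2, slope_def_field, Complex.sin_zero, sub_zero, sub_zero]
    push_cast
    rw [div_div_eq_mul_div]
    ring
  rw [this, Complex.ofReal_re]

/-- Dividing the even power series of `sharpNumerator L` by x^2 gives the Laurent expansion. Its
disc of radius 2π, reaching to the first nonzero zeros of sin(w/2), is the same for every L. -/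
theorem hasSharp_cos_div_sin {t : ℝ} (ht0 : t ≠ 0) (ht : |t| < 2 * Real.pi) (L : ℕ) :
    HasSharp (fun x : ℝ => Real.cos ((L : ℝ) * x / 2) / (x * Real.sin (x / 2))) t
      (∫ r in (0 : ℝ)..1, 2 * ((sharpNumerator L t).re - (sharpNumerator L (t * r : ℝ)).re) /
        (t ^ 2 * (1 - r ^ 2))) := by
  obtain ⟨c, hc⟩ := exists_hasSum_even_powers (differentiableOn_sharpNumerator L)
    (sharpNumerator_neg L)
  refine ⟨c, ?_, hasSum_sharp hc ht0 ht⟩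
  have hball : ∀ᶠ x : ℝ in 𝓝[≠] 0, |x| < 2 * Real.pi := by
    refine nhdsWithin_le_nhds ?_
    have := Metric.ball_mem_nhds (0 : ℝ) Real.two_pi_pos
    filter_upwards [this] with x hx
    simpa using hx
  filter_upwards [hball, self_mem_nhdsWithin] with x hx hx0
  have hx0' : x ≠ 0 := hx0
  have h := (hc x hx).div_const (x ^ 2)
  rw [sharpNumerator_ofReal_re L hx0'] at h
  have hv : x * Real.cos (L * x / 2) / Real.sin (x / 2) / x ^ 2 =
      Real.cos (L * x / 2) / (x * Real.sin (x / 2)) := by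
    field_simp
  rw [hv] at h
  refine h.congr_fun fun j => ?_
  rw [zpow_sub₀ hx0', mul_div_assoc]
  norm_cast

/-! ### Analyticity and evenness of f -/

theorem AnalyticAt.dslope_of_analyticAt {f : ℝ → ℝ} {a x : ℝ} (ha : AnalyticAt ℝ f a)
    (hx : AnalyticAt ℝ f x) : AnalyticAt ℝ (dslope f a) x := by
  rcases eq_or_ne x a with rfl | hne
  · obtain ⟨p, hp⟩ := hx
    exact ⟨_, hp.has_fpower_series_dslope_fslope⟩
  · refine AnalyticAt.congr ?_ (dslope_eventuallyEq_slope_of_ne f hne).symm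
    have : slope f a = fun y => (f y - f a) / (y - a) := funext fun y => slope_def_field f a y
    rw [this]
    exact (hx.sub analyticAt_const).div (analyticAt_id.sub analyticAt_const) (sub_ne_zero.2 hne)

theorem analyticAt_sinc (x : ℝ) : AnalyticAt ℝ Real.sinc x := by
  rw [Real.sinc_eq_dslope]
  exact Real.analyticAt_sin.dslope_of_analyticAt Real.analyticAt_sin

theorem sinc_ne_zero {x : ℝ} (hx : |x| < Real.pi) : Real.sinc x ≠ 0 := by
  rcases eq_or_ne x 0 with rfl | h0
  · simp
  · rw [Real.sinc_of_ne_zero h0]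
    refine div_ne_zero (fun h => h0 ?_) h0
    exact (Real.sin_eq_zero_iff_of_lt_of_lt (abs_lt.1 hx).1 (abs_lt.1 hx).2).1 h

/-- The analytic extension of `r / sin (t r / 2)`. -/
noncomputable def divSin (t r : ℝ) : ℝ := 2 / (t * Real.sinc (t * r / 2))

theorem divSin_of_ne_zero {t r : ℝ} (ht : t ≠ 0) (hr : r ≠ 0) :
    divSin t r = r / Real.sin (t * r / 2) := by
  rw [divSin, Real.sinc_of_ne_zero (by positivity)]
  rcases eq_or_ne (Real.sin (t * r / 2)) 0 with h | h
  · simp [h]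
  · field_simp

theorem analyticAt_divSin {t r : ℝ} (ht : t ≠ 0) (hr : |t * r / 2| < Real.pi) :
    AnalyticAt ℝ (divSin t) r := by
  unfold divSin
  refine analyticAt_const.div (analyticAt_const.mul ?_) (mul_ne_zero ht (sinc_ne_zero hr))
  exact (analyticAt_sinc _).comp_of_eq
    ((analyticAt_const.mul analyticAt_id).div analyticAt_const two_ne_zero) rfl

/-- An analytic formula for `torsionAux` on a neighbourhood of `[0, 1]`. -/
noncomputable def torsionSmooth (t r : ℝ) : ℝ := -dslope (divSin t) 1 r / (t * (1 + r))

theorem abs_mul_div_two_lt {t r : ℝ} (ht : |t| < 2 * Real.pi) (h1 : -1 < r)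
    (h2 : |t| * r < 2 * Real.pi) : |t * r / 2| < Real.pi := by
  rw [abs_div, abs_mul, abs_two, div_lt_iff₀ two_pos]
  rcases abs_cases r with ⟨h, _⟩ | ⟨h, _⟩ <;> rw [h]
  · linarith
  · nlinarith [abs_nonneg t]

/-- The `dslope` at 1 absorbs the factor 1 - r of 1 - r^2; the remaining factor 1 + r is harmless
for r > -1. -/
theorem analyticAt_torsionSmooth {t r : ℝ} (ht0 : t ≠ 0) (ht : |t| < 2 * Real.pi) (h1 : -1 < r)
    (h2 : |t| * r < 2 * Real.pi) : AnalyticAt ℝ (torsionSmooth t) r := by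
  unfold torsionSmooth
  refine AnalyticAt.div (AnalyticAt.neg ?_)
    (analyticAt_const.mul (analyticAt_const.add analyticAt_id))
    (mul_ne_zero ht0 (by linarith : (0 : ℝ) < 1 + r).ne')
  exact (analyticAt_divSin ht0 (abs_mul_div_two_lt ht (by norm_num) (by linarith))
    ).dslope_of_analyticAt (analyticAt_divSin ht0 (abs_mul_div_two_lt ht h1 h2))

theorem torsionSmooth_eq {t r : ℝ} (ht0 : t ≠ 0) (hr0 : r ≠ 0) (hr1 : r ≠ 1) :
    torsionSmooth t r =
      (r / Real.sin (t * r / 2) - 1 / Real.sin (t / 2)) * (1 / (t * (1 - r ^ 2))) := by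
  rw [torsionSmooth, dslope_of_ne _ hr1, slope_def_field, divSin_of_ne_zero ht0 hr0,
    divSin_of_ne_zero ht0 one_ne_zero, mul_one, ← div_neg, neg_sub, div_div, mul_one_div]
  congr 1
  ring

theorem torsionAux_eq_torsionSmooth {t r : ℝ} (ht0 : t ≠ 0) (ht : |t| < 2 * Real.pi) (h1 : -1 < r)
    (h2 : |t| * r < 2 * Real.pi) : torsionAux t r = torsionSmooth t r := by
  refine extendFrom_eq ?_ ?_
  · exact (Set.toFinite _).countable.dense_compl ℝ r
  · refine ((analyticAt_torsionSmooth ht0 ht h1 h2).continuousAt.tendsto.mono_left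
      nhdsWithin_le_nhds).congr' ?_
    filter_upwards [self_mem_nhdsWithin] with y hy
    simp only [Set.mem_compl_iff, Set.mem_insert_iff, Set.mem_singleton_iff, not_or] at hy
    exact torsionSmooth_eq ht0 hy.2.1 hy.2.2

theorem torsionSmooth_neg {t r : ℝ} (ht0 : t ≠ 0) (h1 : |r| < 1) :
    torsionSmooth t (-r) = torsionSmooth t r := by
  obtain ⟨ha, hb⟩ := abs_lt.1 h1
  rcases eq_or_ne r 0 with rfl | hr0
  · rw [neg_zero]
  · rw [torsionSmooth_eq ht0 hr0 hb.ne, torsionSmooth_eq ht0 (neg_ne_zero.2 hr0) (by linarith),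
      mul_neg, neg_div (2 : ℝ), Real.sin_neg, neg_div_neg_eq, neg_sq]

theorem iteratedDeriv_torsionSmooth_zero {t : ℝ} (ht0 : t ≠ 0) {n : ℕ} (hn : Odd n) :
    iteratedDeriv n (torsionSmooth t) 0 = 0 := by
  have h1 := iteratedDeriv_comp_neg n (torsionSmooth t) 0
  have h2 : (fun r => torsionSmooth t (-r)) =ᶠ[𝓝 0] torsionSmooth t := by
    filter_upwards [Metric.ball_mem_nhds (0 : ℝ) one_pos] with r hr
    exact torsionSmooth_neg ht0 (by simpa using hr)
  rw [h2.iteratedDeriv_eq, hn.neg_one_pow, neg_zero, neg_smul, one_smul] at h1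
  exact self_eq_neg.1 h1

theorem iteratedDeriv_torsionAux_one {t : ℝ} (ht0 : t ≠ 0) (ht : |t| < 2 * Real.pi) (n : ℕ) :
    iteratedDeriv n (torsionAux t) 1 = iteratedDeriv n (torsionSmooth t) 1 := by
  refine Filter.EventuallyEq.iteratedDeriv_eq n ?_
  have h2 : ∀ᶠ r : ℝ in 𝓝 1, |t| * r < 2 * Real.pi :=
    (continuous_const.mul continuous_id).continuousAt.eventually_lt continuousAt_const
      (by simpa using ht)
  filter_upwards [h2, lt_mem_nhds (show (-1 : ℝ) < 1 by norm_num)] with r hr hr1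
  exact torsionAux_eq_torsionSmooth ht0 ht hr1 hr

/-! ### Oscillatory integrals by repeated integration by parts -/

theorem integral_iteratedDeriv_mul_cos {f : ℝ → ℝ} (hf : ∀ r ∈ Set.Icc (0 : ℝ) 1, AnalyticAt ℝ f r)
    (hodd : ∀ n, Odd n → iteratedDeriv n f 0 = 0) {l : ℝ} (hl : 0 < l) (n : ℕ) :
    ∫ r in (0 : ℝ)..1, iteratedDeriv n f r * Real.cos (l * r + n * (Real.pi / 2)) =
      l⁻¹ * (iteratedDeriv n f 1 * Real.sin (l + n * (Real.pi / 2)) +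
        ∫ r in (0 : ℝ)..1, iteratedDeriv (n + 1) f r *
          Real.cos (l * r + (n + 1 : ℕ) * (Real.pi / 2))) := by
  have hu : Set.uIcc (0 : ℝ) 1 = Set.Icc 0 1 := Set.uIcc_of_le zero_le_one
  have han : ∀ k, ∀ r ∈ Set.Icc (0 : ℝ) 1, AnalyticAt ℝ (iteratedDeriv k f) r := fun k r hr => by
    rw [iteratedDeriv_eq_iterate]
    exact (hf r hr).iterated_deriv k
  have hcont : ∀ k, ContinuousOn (iteratedDeriv k f) (Set.uIcc 0 1) := fun k r hr =>
    (han k r (hu ▸ hr)).continuousAt.continuousWithinAt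
  have h := intervalIntegral.integral_mul_deriv_eq_deriv_mul (a := 0) (b := 1)
    (u := iteratedDeriv n f) (u' := iteratedDeriv (n + 1) f)
    (v := fun r => l⁻¹ * Real.sin (l * r + n * (Real.pi / 2)))
    (v' := fun r => Real.cos (l * r + n * (Real.pi / 2))) (fun r hr => ?_) (fun r _ => ?_)
    (hcont (n + 1)).intervalIntegrable
    ((by fun_prop : Continuous _).intervalIntegrable _ _)
  · have hzero : iteratedDeriv n f 0 * (l⁻¹ * Real.sin (l * 0 + n * (Real.pi / 2))) = 0 := by
      rcases Nat.even_or_odd n with ⟨k, hk⟩ | hn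
      · rw [mul_zero, zero_add, hk, show ((k + k : ℕ) : ℝ) * (Real.pi / 2) = k * Real.pi by
          push_cast; ring, Real.sin_nat_mul_pi]
        ring
      · rw [hodd n hn, zero_mul]
    have hintg : ∫ r in (0 : ℝ)..1, iteratedDeriv (n + 1) f r *
        (l⁻¹ * Real.sin (l * r + n * (Real.pi / 2))) =
        -(l⁻¹ * ∫ r in (0 : ℝ)..1, iteratedDeriv (n + 1) f r *
          Real.cos (l * r + (n + 1 : ℕ) * (Real.pi / 2))) := by
      rw [← intervalIntegral.integral_const_mul, ← intervalIntegral.integral_neg]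
      congr 1
      ext r
      rw [show l * r + (n + 1 : ℕ) * (Real.pi / 2) = l * r + n * (Real.pi / 2) + Real.pi / 2 by
        push_cast; ring, Real.cos_add_pi_div_two]
      ring
    rw [h, hzero, hintg, mul_one]
    ring
  · rw [iteratedDeriv_succ]
    exact (han n r (hu ▸ hr)).differentiableAt.hasDerivAt
  · have h1 : HasDerivAt (fun r : ℝ => l * r + n * (Real.pi / 2)) (l * 1) r :=
      ((hasDerivAt_id r).const_mul l).add_const _
    refine (h1.sin.const_mul l⁻¹).congr_deriv ?_
    field_simp

theorem integral_mul_cos_expansion {f : ℝ → ℝ} (hf : ∀ r ∈ Set.Icc (0 : ℝ) 1, AnalyticAt ℝ f r)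
    (hodd : ∀ n, Odd n → iteratedDeriv n f 0 = 0) (M : ℕ) {l : ℝ} (hl : 0 < l) :
    ∫ r in (0 : ℝ)..1, f r * Real.cos (l * r) =
      -∑ n ∈ Finset.range M, (l⁻¹) ^ (n + 1) * Real.cos (l + (n + 1 : ℕ) * (Real.pi / 2)) *
        iteratedDeriv n f 1 + (l⁻¹) ^ M * ∫ r in (0 : ℝ)..1, iteratedDeriv M f r *
          Real.cos (l * r + M * (Real.pi / 2)) := by
  induction M with
  | zero => simp
  | succ M ih =>
    rw [ih, integral_iteratedDeriv_mul_cos hf hodd hl, Finset.sum_range_succ,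
      show l + (M + 1 : ℕ) * (Real.pi / 2) = l + M * (Real.pi / 2) + Real.pi / 2 by
        push_cast; ring, Real.cos_add_pi_div_two]
    ring

/-- One integration by parts beyond the M retained terms: its boundary term and the remaining
integral are bounded independently of l, which gains the extra power of 1/l. -/
theorem exists_abs_integral_mul_cos_le {f : ℝ → ℝ}
    (hf : ∀ r ∈ Set.Icc (0 : ℝ) 1, AnalyticAt ℝ f r)
    (hodd : ∀ n, Odd n → iteratedDeriv n f 0 = 0) (M : ℕ) :
    ∃ C : ℝ, ∀ l : ℝ, 0 < l → |(∫ r in (0 : ℝ)..1, f r * Real.cos (l * r)) +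
      ∑ n ∈ Finset.range M, (l⁻¹) ^ (n + 1) * Real.cos (l + (n + 1 : ℕ) * (Real.pi / 2)) *
        iteratedDeriv n f 1| ≤ C * (l⁻¹) ^ (M + 1) := by
  have hu : Set.uIcc (0 : ℝ) 1 = Set.Icc 0 1 := Set.uIcc_of_le zero_le_one
  have hcont : ContinuousOn (iteratedDeriv (M + 1) f) (Set.Icc 0 1) := fun r hr => by
    rw [iteratedDeriv_eq_iterate]
    exact ((hf r hr).iterated_deriv _).continuousAt.continuousWithinAt
  obtain ⟨K, hK⟩ := isCompact_Icc.exists_bound_of_continuousOn hcont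
  refine ⟨|iteratedDeriv M f 1| + K, fun l hl => ?_⟩
  have hbound : |∫ r in (0 : ℝ)..1, iteratedDeriv (M + 1) f r *
      Real.cos (l * r + (M + 1 : ℕ) * (Real.pi / 2))| ≤ K := by
    have := intervalIntegral.norm_integral_le_of_norm_le_const (a := 0) (b := 1) (C := K)
      (f := fun r => iteratedDeriv (M + 1) f r * Real.cos (l * r + (M + 1 : ℕ) * (Real.pi / 2)))
      fun r hr => by
        rw [Set.uIoc_of_le zero_le_one] at hr
        rw [norm_mul]
        refine (mul_le_of_le_one_right (norm_nonneg _) (Real.abs_cos_le_one _)).trans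
          (hK r ⟨hr.1.le, hr.2⟩)
    simpa using this
  have hsin : |iteratedDeriv M f 1 * Real.sin (l + M * (Real.pi / 2))| ≤ |iteratedDeriv M f 1| := by
    rw [abs_mul]
    exact mul_le_of_le_one_right (abs_nonneg _) (Real.abs_sin_le_one _)
  rw [integral_mul_cos_expansion hf hodd M hl, integral_iteratedDeriv_mul_cos hf hodd hl,
    neg_add_cancel_comm, ← mul_assoc, ← pow_succ, abs_mul, abs_of_pos (by positivity), mul_comm]
  exact mul_le_mul_of_nonneg_right ((abs_add_le _ _).trans (add_le_add hsin hbound)) (by positivity)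

/-! ### Assembly of the expansion of the #-term -/

/-- Adding and subtracting cos(lr)/sin(t/2), with l = Lt/2, separates the universal kernel (cos l -
cos lr)/(1 - r^2) from f(r) cos(lr), where f is smooth on [0,1]. -/
theorem sharp_integral_eq {t : ℝ} (ht0 : 0 < t) (ht : t < 2 * Real.pi) (L : ℕ) :
    ∫ r in (0 : ℝ)..1, 2 * ((sharpNumerator L t).re - (sharpNumerator L (t * r : ℝ)).re) /
        (t ^ 2 * (1 - r ^ 2)) =
      1 / (t * Real.sin (t / 2)) * (∫ r in (0 : ℝ)..1,
        (cosDiffQuot (L * t / 2) (1 - r) + cosDiffQuot (L * t / 2) (1 + r))) -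
      2 * ∫ r in (0 : ℝ)..1, torsionSmooth t r * Real.cos (L * t / 2 * r) := by
  have habs : |t| < 2 * Real.pi := by rwa [abs_of_pos ht0]
  have hsin : ∀ x : ℝ, 0 < x → x < 2 * Real.pi → Real.sin (x / 2) ≠ 0 := fun x h1 h2 =>
    (Real.sin_pos_of_pos_of_lt_pi (by linarith) (by linarith)).ne'
  have hq := continuous_cosDiffQuot (L * t / 2)
  have hf : ContinuousOn (torsionSmooth t) (Set.uIcc 0 1) := fun r hr => by
    rw [Set.uIcc_of_le zero_le_one] at hr
    refine (analyticAt_torsionSmooth ht0.ne' habs (by linarith [hr.1]) ?_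
      ).continuousAt.continuousWithinAt
    rw [abs_of_pos ht0]
    nlinarith [hr.2]
  have hi : IntervalIntegrable (fun r => 2 * (torsionSmooth t r * Real.cos (L * t / 2 * r)))
      MeasureTheory.volume 0 1 :=
    (continuousOn_const.mul (hf.mul (by fun_prop))).intervalIntegrable
  rw [← intervalIntegral.integral_const_mul, ← intervalIntegral.integral_const_mul,
    ← intervalIntegral.integral_sub ((by fun_prop : Continuous _).intervalIntegrable _ _) hi]
  refine intervalIntegral.integral_congr_ae ?_
  have hne : ∀ᵐ r : ℝ ∂MeasureTheory.volume, r ≠ 1 := by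
    simp [MeasureTheory.ae_iff]
  filter_upwards [hne] with r hr1 hr
  rw [Set.uIoc_of_le zero_le_one] at hr
  have hlt : r < 1 := lt_of_le_of_ne hr.2 hr1
  have h1 : 1 - r ≠ 0 := by linarith
  have h2 : 1 + r ≠ 0 := by linarith [hr.1]
  have h3 : 1 - r ^ 2 ≠ 0 := by nlinarith [hr.1]
  have hs1 := hsin t ht0 ht
  have hs2 := hsin (t * r) (mul_pos ht0 hr.1) (by nlinarith [hr.1])
  rw [sharpNumerator_ofReal_re L ht0.ne', sharpNumerator_ofReal_re L (mul_pos ht0 hr.1).ne',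
    cosDiffQuot_add h1 h2, torsionSmooth_eq ht0.ne' hr.1.ne' hr1,
    show (L : ℝ) * (t * r) / 2 = L * t / 2 * r by ring]
  field_simp
  ring

theorem isBigO_inv_pow_of_le {g : ℕ → ℝ} {C t : ℝ} (ht : 0 < t) {N p : ℕ} (hp : N ≤ p)
    (h : ∀ L : ℕ, 1 ≤ L → |g L| ≤ C * (((L : ℝ) * t) ^ p)⁻¹) :
    g =O[atTop] fun L : ℕ => ((L : ℝ) ^ N)⁻¹ := by
  refine Asymptotics.IsBigO.of_bound (|C| * (t ^ p)⁻¹) ?_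
  filter_upwards [eventually_ge_atTop 1] with L hL
  have hL' : (1 : ℝ) ≤ L := by exact_mod_cast hL
  rw [Real.norm_eq_abs, Real.norm_of_nonneg (by positivity)]
  calc |g L| ≤ C * (((L : ℝ) * t) ^ p)⁻¹ := h L hL
    _ ≤ |C| * (((L : ℝ) * t) ^ p)⁻¹ := by gcongr; exact le_abs_self C
    _ = |C| * (t ^ p)⁻¹ * ((L : ℝ) ^ p)⁻¹ := by rw [mul_pow, mul_inv]; ring
    _ ≤ _ := by gcongr

theorem sharp_expansion {t : ℝ} (ht0 : 0 < t) (ht : t < 2 * Real.pi) (N : ℕ) :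
    (fun L : ℕ => (∫ r in (0 : ℝ)..1,
        2 * ((sharpNumerator L t).re - (sharpNumerator L (t * r : ℝ)).re) /
          (t ^ 2 * (1 - r ^ 2))) -
          (-(1 / (t * Real.sin (t / 2))) *
              (Real.sin ((L : ℝ) * t / 2) *
                  (Real.pi / 2 + ∑ m ∈ (Finset.range N).filter (fun m => 2 * m + 1 < N),
                    (-1) ^ m * ((2 * m).factorial : ℝ) / ((L : ℝ) * t) ^ (2 * m + 1))
                + Real.cos ((L : ℝ) * t / 2) *
                  (-Real.log ((L : ℝ) * t) + deriv Real.Gamma 1 +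
                    ∑ m ∈ (Finset.Icc 1 N).filter (fun m => 2 * m < N),
                      (-1) ^ m * ((2 * m - 1).factorial : ℝ) / ((L : ℝ) * t) ^ (2 * m)))
            + ∑ m ∈ Finset.Icc 1 (N - 1),
                2 * (2 / ((L : ℝ) * t)) ^ m * Real.cos (((L : ℝ) * t + Real.pi * m) / 2) *
                  iteratedDeriv (m - 1) (torsionAux t) 1))
          =O[atTop] fun L : ℕ => ((L : ℝ) ^ N)⁻¹ := by
  have habs : |t| < 2 * Real.pi := by rwa [abs_of_pos ht0]
  have han : ∀ r ∈ Set.Icc (0 : ℝ) 1, AnalyticAt ℝ (torsionSmooth t) r := fun r hr => by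
    refine analyticAt_torsionSmooth ht0.ne' habs (by linarith [hr.1]) ?_
    rw [abs_of_pos ht0]
    nlinarith [hr.2]
  obtain ⟨C, hC⟩ := exists_abs_integral_mul_cos_le han
    (fun n hn => iteratedDeriv_torsionSmooth_zero ht0.ne' hn) (N - 1)
  -- The truncations at powers below N keep N/2 terms of the odd series and (N-1)/2 of the even one;
  -- the first omitted powers 2(N/2) + 1 and 2((N-1)/2) + 2 are both at least N. For N = 0 the
  -- truncated subtraction leaves empty sums.
  have hA : (Finset.range N).filter (fun m => 2 * m + 1 < N) = Finset.range (N / 2) := by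
    ext m; simp only [Finset.mem_filter, Finset.mem_range]; omega
  have hB : (Finset.Icc 1 N).filter (fun m => 2 * m < N) = Finset.Icc 1 ((N - 1) / 2) := by
    ext m; simp only [Finset.mem_filter, Finset.mem_Icc]; omega
  set tailA : ℕ → ℝ := fun L =>
    -(1 / (t * Real.sin (t / 2))) * Real.sin ((L : ℝ) * t / 2) *
      ((-1) ^ (N / 2) * laplaceAux (2 * (N / 2) + 0) (L * t)) with htA
  set tailB : ℕ → ℝ := fun L =>
    1 / (t * Real.sin (t / 2)) * Real.cos ((L : ℝ) * t / 2) *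
      ((-1) ^ ((N - 1) / 2) * laplaceAux (2 * ((N - 1) / 2) + 1) (L * t)) with htB
  set tailF : ℕ → ℝ := fun L => -(2 * ((∫ r in (0 : ℝ)..1,
    torsionSmooth t r * Real.cos (L * t / 2 * r)) + ∑ n ∈ Finset.range (N - 1),
      ((L * t / 2 : ℝ)⁻¹) ^ (n + 1) * Real.cos (L * t / 2 + (n + 1 : ℕ) * (Real.pi / 2)) *
        iteratedDeriv n (torsionSmooth t) 1)) with htF
  have hneg : ∀ M : ℕ, |(-1 : ℝ) ^ M| = 1 := fun M => by simp
  have oA : tailA =O[atTop] fun L : ℕ => ((L : ℝ) ^ N)⁻¹ := by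
    refine isBigO_inv_pow_of_le (p := 2 * (N / 2) + 0 + 1)
      (C := |1 / (t * Real.sin (t / 2))| * (2 * (N / 2) + 0).factorial) ht0 (by omega)
      fun L hL => ?_
    have hx : (0 : ℝ) < L * t := mul_pos (by exact_mod_cast hL) ht0
    rw [htA]
    simp only [abs_mul, abs_neg, hneg, one_mul]
    rw [mul_assoc |1 / _|, mul_assoc |1 / _|, ← div_eq_mul_inv]
    refine mul_le_mul_of_nonneg_left ?_ (abs_nonneg _)
    exact (mul_le_mul (Real.abs_sin_le_one _) (abs_laplaceAux_le _ hx) (abs_nonneg _)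
      zero_le_one).trans_eq (one_mul _)
  have oB : tailB =O[atTop] fun L : ℕ => ((L : ℝ) ^ N)⁻¹ := by
    refine isBigO_inv_pow_of_le (p := 2 * ((N - 1) / 2) + 1 + 1)
      (C := |1 / (t * Real.sin (t / 2))| * (2 * ((N - 1) / 2) + 1).factorial) ht0 (by omega)
      fun L hL => ?_
    have hx : (0 : ℝ) < L * t := mul_pos (by exact_mod_cast hL) ht0
    rw [htB]
    simp only [abs_mul, hneg, one_mul]
    rw [mul_assoc |1 / _|, mul_assoc |1 / _|, ← div_eq_mul_inv]
    refine mul_le_mul_of_nonneg_left ?_ (abs_nonneg _)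
    exact (mul_le_mul (Real.abs_cos_le_one _) (abs_laplaceAux_le _ hx) (abs_nonneg _)
      zero_le_one).trans_eq (one_mul _)
  have oF : tailF =O[atTop] fun L : ℕ => ((L : ℝ) ^ N)⁻¹ := by
    refine isBigO_inv_pow_of_le (p := N - 1 + 1) (C := 2 * (C * 2 ^ (N - 1 + 1))) ht0 (by omega)
      fun L hL => ?_
    have hL' : (0 : ℝ) < L := by exact_mod_cast hL
    have := hC (L * t / 2) (by positivity)
    rw [htF]
    simp only [abs_neg]
    rw [abs_mul, abs_two, mul_assoc]
    refine mul_le_mul_of_nonneg_left (this.trans_eq ?_) two_pos.le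
    rw [inv_div, div_pow]
    ring
  -- The error is exactly the sum of the three tails once L ≥ 1, so its order is that of the tails.
  refine ((oA.add oB).add oF).congr' ?_ EventuallyEq.rfl
  filter_upwards [eventually_ge_atTop 1] with L hL
  have hL' : (0 : ℝ) < L := by exact_mod_cast hL
  have hx : (0 : ℝ) < L * t := by positivity
  have eA := laplaceAux_eq_sum_add 0 (N / 2) hx
  have eB := laplaceAux_eq_sum_add 1 ((N - 1) / 2) hx
  have sA : ∑ m ∈ Finset.range (N / 2), (-1) ^ m * ((2 * m).factorial : ℝ) /
      ((L : ℝ) * t) ^ (2 * m + 1) = laplaceAux 0 (L * t) -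
      (-1) ^ (N / 2) * laplaceAux (2 * (N / 2) + 0) (L * t) := by
    rw [eq_sub_iff_add_eq]; exact eA.symm
  have sB : ∑ m ∈ Finset.Icc 1 ((N - 1) / 2), (-1) ^ m * ((2 * m - 1).factorial : ℝ) /
      ((L : ℝ) * t) ^ (2 * m) = -(laplaceAux 1 (L * t) -
      (-1) ^ ((N - 1) / 2) * laplaceAux (2 * ((N - 1) / 2) + 1) (L * t)) := by
    rw [eB, add_sub_cancel_right, sum_Icc_one_eq_sum_range, ← Finset.sum_neg_distrib]
    refine Finset.sum_congr rfl fun m _ => ?_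
    rw [show 2 * (m + 1) - 1 = 2 * m + 1 by omega, show 2 * (m + 1) = 2 * m + 1 + 1 by ring]
    ring
  have sF : ∑ m ∈ Finset.Icc 1 (N - 1),
      2 * (2 / ((L : ℝ) * t)) ^ m * Real.cos (((L : ℝ) * t + Real.pi * m) / 2) *
        iteratedDeriv (m - 1) (torsionAux t) 1 = 2 * ∑ n ∈ Finset.range (N - 1),
      ((L * t / 2 : ℝ)⁻¹) ^ (n + 1) * Real.cos (L * t / 2 + (n + 1 : ℕ) * (Real.pi / 2)) *
        iteratedDeriv n (torsionSmooth t) 1 := by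
    rw [sum_Icc_one_eq_sum_range, Finset.mul_sum]
    refine Finset.sum_congr rfl fun n _ => ?_
    rw [Nat.add_sub_cancel, iteratedDeriv_torsionAux_one ht0.ne' habs, inv_div,
      show ((L : ℝ) * t + Real.pi * (n + 1 : ℕ)) / 2 = L * t / 2 + (n + 1 : ℕ) * (Real.pi / 2) by
        ring]
    ring
  rw [hA, hB, sA, sB, sF, sharp_integral_eq ht0 ht, integral_cosDiffQuot_add (by positivity),
    show 2 * ((L : ℝ) * t / 2) = L * t by ring]
  simp only [htA, htB, htF]
  ring

theorem theorem9p1 (t : ℝ) (ht0 : t ≠ 0) (ht : |t| < 2 * Real.pi) :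
    -- the logarithmic sum
    (∀ N L : ℕ, 1 ≤ N → 1 ≤ L →
      ((∑ k ∈ Finset.Icc 1 L,
          Real.sin ((2 * (k : ℝ) - L) * t / 2) / Real.sin (t / 2) * Real.log k : ℝ) : ℂ) =
        ((-(Real.cos (((L : ℝ) + 1) * t / 2) / (2 * Real.sin (t / 2) ^ 2)) * Real.log L : ℝ) : ℂ)
        - 1 / (2 * Complex.I * Complex.sin (t / 2)) *
            (Complex.exp (-(Complex.I * ((L : ℂ) - 2) * t / 2)) *
                deriv (fun s : ℂ => lerchPhi (Complex.exp (Complex.I * t)) s 1) 0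
              - Complex.exp (Complex.I * ((L : ℂ) - 2) * t / 2) *
                deriv (fun s : ℂ => lerchPhi (Complex.exp (-(Complex.I * t))) s 1) 0)
        + 1 / (2 * Complex.I * Complex.sin (t / 2)) *
            ∑ m ∈ Finset.Icc 1 (N - 1), ((-(L : ℂ)) ^ m)⁻¹ / m *
              (Complex.exp (Complex.I * ((L : ℂ) + 2) * t / 2) *
                  lerchPhi (Complex.exp (Complex.I * t)) (-m) 1
                - Complex.exp (-(Complex.I * ((L : ℂ) + 2) * t / 2)) *
                  lerchPhi (Complex.exp (-(Complex.I * t))) (-m) 1)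
        + 1 / (2 * Complex.I * Complex.sin (t / 2)) * (((-(L : ℂ)) ^ N)⁻¹ / N) *
            (Complex.exp (Complex.I * ((L : ℂ) + 2) * t / 2) *
                lerchRemainder (Complex.exp (Complex.I * t)) N 1 0 L
              - Complex.exp (-(Complex.I * ((L : ℂ) + 2) * t / 2)) *
                lerchRemainder (Complex.exp (-(Complex.I * t))) N 1 0 L)) ∧
    -- the bound for the remainders, uniform in `L`
    (∀ N L : ℕ, 1 ≤ N → 1 ≤ L →
      ‖lerchRemainder (Complex.exp (Complex.I * t)) N 1 0 L‖ <
        (N.factorial : ℝ) / (2 * Real.pi) ^ (N + 1) *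
          (hurwitzSum (N + 1) (|t| / (2 * Real.pi)) +
            hurwitzSum (N + 1) (1 - |t| / (2 * Real.pi))) ∧
      ‖lerchRemainder (Complex.exp (-(Complex.I * t))) N 1 0 L‖ <
        (N.factorial : ℝ) / (2 * Real.pi) ^ (N + 1) *
          (hurwitzSum (N + 1) (|t| / (2 * Real.pi)) +
            hurwitzSum (N + 1) (1 - |t| / (2 * Real.pi)))) ∧
    -- the `#`-term
    (∃ S : ℕ → ℝ,
      (∀ L : ℕ, HasSharp
        (fun x : ℝ => Real.cos ((L : ℝ) * x / 2) / (x * Real.sin (x / 2))) t (S L)) ∧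
      (0 < t → ∀ N : ℕ,
        (fun L : ℕ => S L -
          (-(1 / (t * Real.sin (t / 2))) *
              (Real.sin ((L : ℝ) * t / 2) *
                  (Real.pi / 2 + ∑ m ∈ (Finset.range N).filter (fun m => 2 * m + 1 < N),
                    (-1) ^ m * ((2 * m).factorial : ℝ) / ((L : ℝ) * t) ^ (2 * m + 1))
                + Real.cos ((L : ℝ) * t / 2) *
                  (-Real.log ((L : ℝ) * t) + deriv Real.Gamma 1 +
                    ∑ m ∈ (Finset.Icc 1 N).filter (fun m => 2 * m < N),
                      (-1) ^ m * ((2 * m - 1).factorial : ℝ) / ((L : ℝ) * t) ^ (2 * m)))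
            + ∑ m ∈ Finset.Icc 1 (N - 1),
                2 * (2 / ((L : ℝ) * t)) ^ m * Real.cos (((L : ℝ) * t + Real.pi * m) / 2) *
                  iteratedDeriv (m - 1) (torsionAux t) 1))
          =O[atTop] fun L : ℕ => ((L : ℝ) ^ N)⁻¹)) := by
  refine ⟨fun N L hN hL => log_sum_expansion ht0 ht hN hL,
    fun N L hN hL => remainder_bounds ht0 ht hN hL, _, fun L => hasSharp_cos_div_sin ht0 ht L,
    fun hpos N => sharp_expansion hpos ?_ N⟩
  rwa [abs_of_pos hpos] at ht
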